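/- Let $k$ be an algebraically closed field of characteristic $0$. A *quasi-bialgebra* over $k$ is a tuple $(H,\Delta,\varepsilon,\Phi)$, where $H$ is a unital associative $k$-algebra, $\Delta:H\to H\otimes H$ and $\varepsilon:H\to k$ are algebra maps, and $\Phi\in H\otimes H\otimes H$ is invertible, such that for all $h\in H$ $$(\varepsilon\otimes \mathrm{id})\Delta(h)=h=(\mathrm{id}\otimes\varepsilon)\Delta(h),\qquad \Phi\,(\Delta\otimes\mathrm{id})\Delta(h)=(\mathrm{id}\otimes\Delta)\Delta(h)\,\Phi,$$ $$(\mathrm{id}\otimes\mathrm{id}\otimes\Delta)(\Phi)\,(\Delta\otimes\mathrm{id}\otimes\mathrm{id})(\Phi)=(1\otimes\Phi)\,(\mathrm{id}\otimes\Delta\otimes\mathrm{id})(\Phi)\,(\Phi\otimes1),\qquad (\mathrm{id}\otimes\varepsilon\otimes\mathrm{id})(\Phi)=1\otimes1 .$$ A *quasi-Hopf algebra* $(H,\Delta,\varepsilon,\Phi,\alpha,\beta,S)$ consists of a quasi-bialgebra together with elements $\alpha,\beta\in H$ and a $k$-linear algebra anti-automorphism $S$ of $H$ such that, writing $\Phi=\sum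 X_i\otimes Y_i\otimes Z_i$, $\Phi^{-1}=\sum \overline X_i\otimes\overline Y_i\otimes\overline Z_i$ and $\Delta(h)=\sum h_1\otimes h_2$, $$\sum S(h_1)\alpha h_2=\varepsilon(h)\alpha,\quad \sum h_1\beta S(h_2)=\varepsilon(h)\beta,\quad \sum X_i\beta S(Y_i)\alpha Z_i=1,\quad \sum S(\overline X_i)\alpha\overline Y_i\beta S(\overline Z_i)=1 .$$ The category $H\text{-}\mathbf{mod}$ of left $H$-modules and $H$-linear maps is a $k$-linear tensor category: $H$ acts on $M\otimes_k N$ through $\Delta$, the unit object is $k$ with action through $\varepsilon$, the associativity constraint $(M\otimes N)\otimes P\to M\otimes(N\otimes P)$ is $(m\otimes n)\otimes p\mapsto \Phi\cdot(m\otimes(n\otimes p))$, and the unit constraints are those of vector spaces. Let $H$ be finite-dimensional and semisimple. Then there is a unique $\Lambda\in H$ with $h\Lambda=\varepsilon(h)\Lambda=\Lambda h$ for all $h\in H$ and $\varepsilon(\Lambda)=1$. Put $$q_L=\sum S(\overline X_i)\alpha\overline Y_i\otimes\overline Z_i,\qquad p_L=\sum Y_iS^{-1}(X_i\beta)\otimes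 Z_i,\qquad \nu_H=m\big(q_L\,\Delta(\Lambda)\,p_L\big)\in H,$$ where $m:H\otimes H\to H$ is the multiplication. Let $\mathrm{Irr}(H)$ be the set of characters of the irreducible left $H$-modules. For $\chi\in\mathrm{Irr}(H)$, the scalar $\chi(\nu_H)$ is the *Frobenius–Schur indicator* of $\chi$. **Theorem.** Let $H$ and $H'$ be finite-dimensional semisimple quasi-Hopf algebras over $k$. If $H\text{-}\mathbf{mod}$ and $H'\text{-}\mathbf{mod}$ are equivalent as $k$-linear tensor categories, that is, if there is a $k$-linear strong monoidal functor $H\text{-}\mathbf{mod}\to H'\text{-}\mathbf{mod}$ which is an equivalence of categories, then the families of Frobenius–Schur indicators of $H$ and $H'$ are identical: there is a bijection $e:\mathrm{Irr}(H)\to\mathrm{Irr}(H')$ such that $$e(\chi)(\nu_{H'})=\chi(\nu_H)\qquad\text{for all }\chi\in\mathrm{Irr}(H).$$ -/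

import Mathlib

universe u

open CategoryTheory
open scoped TensorProduct

noncomputable section

/-! ## Quasi-bialgebras and quasi-Hopf algebras

Triple tensor powers are bracketed to the right, `H ⊗ (H ⊗ H)`; all tensor products are over `k`
and carry the componentwise multiplication. -/

/-- A quasi-bialgebra `(H, Δ, ε, Φ)` over `k`. -/
structure QuasiBialgebra (k : Type u) [Field k] (H : Type u) [Ring H] [Algebra k H] where
  /-- the diagonal map `Δ` -/
  comul : H →ₐ[k] H ⊗[k] H
  /-- the counit `ε` -/
  counit : H →ₐ[k] k
  /-- the associator `Φ`, an invertible element of `H ⊗ H ⊗ H` -/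
  Phi : (H ⊗[k] (H ⊗[k] H))ˣ
  /-- `(ε ⊗ id) Δ(h) = h` -/
  counit_comul (h : H) :
    Algebra.TensorProduct.lid k H (Algebra.TensorProduct.map counit (AlgHom.id k H) (comul h)) = h
  /-- `(id ⊗ ε) Δ(h) = h` -/
  comul_counit (h : H) :
    Algebra.TensorProduct.rid k k H (Algebra.TensorProduct.map (AlgHom.id k H) counit (comul h)) = h
  /-- `Φ (Δ ⊗ id)Δ(h) = (id ⊗ Δ)Δ(h) Φ` -/
  Phi_comul (h : H) :
    (Phi : H ⊗[k] (H ⊗[k] H)) * Algebra.TensorProduct.assoc k k k H H H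
        (Algebra.TensorProduct.map comul (AlgHom.id k H) (comul h)) =
      Algebra.TensorProduct.map (AlgHom.id k H) comul (comul h) * (Phi : H ⊗[k] (H ⊗[k] H))
  /-- `(id ⊗ id ⊗ Δ)(Φ) (Δ ⊗ id ⊗ id)(Φ) = (1 ⊗ Φ) (id ⊗ Δ ⊗ id)(Φ) (Φ ⊗ 1)` -/
  pentagon :
    Algebra.TensorProduct.map (AlgHom.id k H)
          (Algebra.TensorProduct.map (AlgHom.id k H) comul) (Phi : H ⊗[k] (H ⊗[k] H)) *
        Algebra.TensorProduct.assoc k k k H H (H ⊗[k] H)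
          (Algebra.TensorProduct.map comul (AlgHom.id k (H ⊗[k] H))
            (Phi : H ⊗[k] (H ⊗[k] H))) =
      ((1 : H) ⊗ₜ[k] (Phi : H ⊗[k] (H ⊗[k] H))) *
        Algebra.TensorProduct.map (AlgHom.id k H)
          ((Algebra.TensorProduct.assoc k k k H H H).toAlgHom.comp
            (Algebra.TensorProduct.map comul (AlgHom.id k H))) (Phi : H ⊗[k] (H ⊗[k] H)) *
        Algebra.TensorProduct.map (AlgHom.id k H)
          (Algebra.TensorProduct.map (AlgHom.id k H)
            (Algebra.TensorProduct.includeLeft : H →ₐ[k] H ⊗[k] H)) (Phi : H ⊗[k] (H ⊗[k] H))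
  /-- `(id ⊗ ε ⊗ id)(Φ) = 1 ⊗ 1` -/
  counit_Phi :
    Algebra.TensorProduct.map (AlgHom.id k H)
      ((Algebra.TensorProduct.lid k H).toAlgHom.comp
        (Algebra.TensorProduct.map counit (AlgHom.id k H))) (Phi : H ⊗[k] (H ⊗[k] H)) = 1

/-- A quasi-Hopf algebra `(H, Δ, ε, Φ, α, β, S)` over `k`. -/
structure QuasiHopfAlgebra (k : Type u) [Field k] (H : Type u) [Ring H] [Algebra k H] extends
    QuasiBialgebra k H where
  /-- the element `α` -/
  alpha : H
  /-- the element `β` -/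
  beta : H
  /-- the antipode `S`, a bijective `k`-linear map that reverses products -/
  antipode : H ≃ₗ[k] H
  antipode_one : antipode 1 = 1
  antipode_mul (a b : H) : antipode (a * b) = antipode b * antipode a
  /-- `∑ S(h₁) α h₂ = ε(h) α` -/
  antipode_comul (h : H) :
    LinearMap.mul' k H (TensorProduct.map
      (LinearMap.mulRight k alpha ∘ₗ antipode.toLinearMap) LinearMap.id (comul h)) =
      counit h • alpha
  /-- `∑ h₁ β S(h₂) = ε(h) β` -/
  comul_antipode (h : H) :
    LinearMap.mul' k H (TensorProduct.map
      LinearMap.id (LinearMap.mulLeft k beta ∘ₗ antipode.toLinearMap) (comul h)) =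
      counit h • beta
  /-- `∑ X β S(Y) α Z = 1`, where `Φ = ∑ X ⊗ Y ⊗ Z` -/
  antipode_Phi :
    LinearMap.mul' k H (TensorProduct.map
      LinearMap.id
      (LinearMap.mul' k H ∘ₗ TensorProduct.map
        (LinearMap.mulRight k alpha ∘ₗ LinearMap.mulLeft k beta ∘ₗ antipode.toLinearMap)
        LinearMap.id)
      (Phi : H ⊗[k] (H ⊗[k] H))) = 1
  /-- `∑ S(X') α Y' β S(Z') = 1`, where `Φ⁻¹ = ∑ X' ⊗ Y' ⊗ Z'` -/
  antipode_Phi_inv :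
    LinearMap.mul' k H (TensorProduct.map
      antipode.toLinearMap
      (LinearMap.mul' k H ∘ₗ TensorProduct.map
        (LinearMap.mulRight k beta ∘ₗ LinearMap.mulLeft k alpha)
        antipode.toLinearMap)
      ((Phi⁻¹ : (H ⊗[k] (H ⊗[k] H))ˣ) : H ⊗[k] (H ⊗[k] H))) = 1

/-! ## The action of a tensor product of algebras on a tensor product of modules -/

section BoxAct

variable {k : Type u} [Field k]
variable {A B C A' B' : Type u} [Ring A] [Algebra k A] [Ring B] [Algebra k B]
  [Ring C] [Algebra k C] [Ring A'] [Algebra k A'] [Ring B'] [Algebra k B']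
variable {U V W : Type u} [AddCommGroup U] [Module k U] [AddCommGroup V] [Module k V]
  [AddCommGroup W] [Module k W]

/-- If `A` acts on `U` and `B` acts on `V`, then `A ⊗ B` acts on `U ⊗ V` factorwise. -/
def boxAct (r : A →ₐ[k] Module.End k U) (s : B →ₐ[k] Module.End k V) :
    A ⊗[k] B →ₐ[k] Module.End k (U ⊗[k] V) :=
  (Module.endTensorEndAlgHom (R := k) (S := k) (A := k) (M := U) (N := V)).comp
    (Algebra.TensorProduct.map r s)

@[simp]
theorem boxAct_tmul (r : A →ₐ[k] Module.End k U) (s : B →ₐ[k] Module.End k V) (a : A) (b : B) :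
    boxAct r s (a ⊗ₜ b) = TensorProduct.map (r a) (s b) := by
  rfl

theorem boxAct_map (r : A →ₐ[k] Module.End k U) (s : B →ₐ[k] Module.End k V)
    (f : A' →ₐ[k] A) (g : B' →ₐ[k] B) (x : A' ⊗[k] B') :
    boxAct r s (Algebra.TensorProduct.map f g x) = boxAct (r.comp f) (s.comp g) x := by
  induction x with
  | zero => simp
  | tmul a b => simp
  | add x y hx hy => simp [hx, hy]

theorem boxAct_assoc (r : A →ₐ[k] Module.End k U) (s : B →ₐ[k] Module.End k V)
    (t : C →ₐ[k] Module.End k W) (y : (A ⊗[k] B) ⊗[k] C) (v : (U ⊗[k] V) ⊗[k] W) :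
    TensorProduct.assoc k U V W (boxAct (boxAct r s) t y v) =
      boxAct r (boxAct s t) (Algebra.TensorProduct.assoc k k k A B C y)
        (TensorProduct.assoc k U V W v) := by
  have : (TensorProduct.assoc k U V W).toLinearMap ∘ₗ boxAct (boxAct r s) t y =
      boxAct r (boxAct s t) (Algebra.TensorProduct.assoc k k k A B C y) ∘ₗ
        (TensorProduct.assoc k U V W).toLinearMap := by
    induction y with
    | zero => simp
    | add x y hx hy => simp only [map_add, LinearMap.comp_add, LinearMap.add_comp, hx, hy]
    | tmul ab c =>
      induction ab with
      | zero => simp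
      | add x y hx hy =>
        simp only [TensorProduct.add_tmul, map_add, LinearMap.comp_add, LinearMap.add_comp, hx, hy]
      | tmul a b =>
        ext u v w
        simp
  exact LinearMap.congr_fun this v

/-- Intertwiners act compatibly with `boxAct`. -/
theorem boxAct_intertwine {U' V' : Type u} [AddCommGroup U'] [Module k U'] [AddCommGroup V']
    [Module k V'] {r : A →ₐ[k] Module.End k U} {s : B →ₐ[k] Module.End k V}
    {r' : A →ₐ[k] Module.End k U'} {s' : B →ₐ[k] Module.End k V'}
    (f : U →ₗ[k] U') (g : V →ₗ[k] V') (hf : ∀ a u, f (r a u) = r' a (f u))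
    (hg : ∀ b v, g (s b v) = s' b (g v)) (x : A ⊗[k] B) (w : U ⊗[k] V) :
    TensorProduct.map f g (boxAct r s x w) = boxAct r' s' x (TensorProduct.map f g w) := by
  induction x with
  | zero => simp
  | add x y hx hy => simp [hx, hy]
  | tmul a b =>
    induction w with
    | zero => simp
    | add x y hx hy => simp only [map_add, hx, hy]
    | tmul u v => simp [hf, hg]

end BoxAct

namespace QuasiBialgebra

variable {k : Type u} [Field k] {H : Type u} [Ring H] [Algebra k H]

/-! ## The tensor category of left modules -/

/-- A left `H`-module (of arbitrary dimension): a `k`-vector space with a unital action of the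
`k`-algebra `H`. -/
structure LMod (Q : QuasiBialgebra k H) : Type (u + 1) where
  /-- the underlying vector space -/
  carrier : Type u
  [addCommGroup : AddCommGroup carrier]
  [module : Module k carrier]
  /-- the action of `H` -/
  act : H →ₐ[k] Module.End k carrier

attribute [instance] LMod.addCommGroup LMod.module

variable {Q : QuasiBialgebra k H}

namespace LMod

/-- `H`-linear maps. -/
@[ext]
structure Hom (M N : LMod Q) where
  /-- the underlying linear map -/
  toLin : M.carrier →ₗ[k] N.carrier
  map_act (h : H) (m : M.carrier) : toLin (M.act h m) = N.act h (toLin m)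

instance : Category (LMod Q) where
  Hom M N := Hom M N
  id M := ⟨LinearMap.id, fun _ _ => rfl⟩
  comp f g := ⟨g.toLin ∘ₗ f.toLin, fun h m => by simp [f.map_act, g.map_act]⟩

@[ext]
theorem hom_ext {M N : LMod Q} {f g : M ⟶ N} (h : f.toLin = g.toLin) : f = g :=
  Hom.ext h

@[simp] theorem id_toLin (M : LMod Q) : Hom.toLin (𝟙 M) = LinearMap.id := rfl

@[simp] theorem comp_toLin {M N P : LMod Q} (f : M ⟶ N) (g : N ⟶ P) :
    Hom.toLin (f ≫ g) = g.toLin ∘ₗ f.toLin := rfl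

theorem toLin_injective (M N : LMod Q) :
    Function.Injective (fun f : M ⟶ N => f.toLin) := fun _ _ h => hom_ext h

instance (M N : LMod Q) : Zero (M ⟶ N) := ⟨⟨0, by simp⟩⟩
instance (M N : LMod Q) : Add (M ⟶ N) :=
  ⟨fun f g => ⟨f.toLin + g.toLin, fun h m => by simp [f.map_act, g.map_act]⟩⟩
instance (M N : LMod Q) : Neg (M ⟶ N) :=
  ⟨fun f => ⟨-f.toLin, fun h m => by simp [f.map_act]⟩⟩
instance (M N : LMod Q) : Sub (M ⟶ N) :=
  ⟨fun f g => ⟨f.toLin - g.toLin, fun h m => by simp [f.map_act, g.map_act]⟩⟩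
instance (M N : LMod Q) : SMul k (M ⟶ N) :=
  ⟨fun c f => ⟨c • f.toLin, fun h m => by simp [f.map_act]⟩⟩
instance (M N : LMod Q) : SMul ℕ (M ⟶ N) :=
  ⟨fun c f => ⟨c • f.toLin, fun h m => by simp [f.map_act]⟩⟩
instance (M N : LMod Q) : SMul ℤ (M ⟶ N) :=
  ⟨fun c f => ⟨c • f.toLin, fun h m => by simp [f.map_act]⟩⟩

instance (M N : LMod Q) : AddCommGroup (M ⟶ N) :=
  (toLin_injective M N).addCommGroup _ rfl (fun _ _ => rfl) (fun _ => rfl) (fun _ _ => rfl)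
    (fun _ _ => rfl) (fun _ _ => rfl)

/-- The underlying linear map, as an additive map. -/
def toLinAddHom (M N : LMod Q) : (M ⟶ N) →+ (M.carrier →ₗ[k] N.carrier) where
  toFun f := f.toLin
  map_zero' := rfl
  map_add' _ _ := rfl

instance (M N : LMod Q) : Module k (M ⟶ N) :=
  (toLin_injective M N).module k (toLinAddHom M N) (fun _ _ => rfl)

@[simp] theorem add_toLin {M N : LMod Q} (f g : M ⟶ N) :
    Hom.toLin (f + g) = f.toLin + g.toLin := rfl

@[simp] theorem smul_toLin {M N : LMod Q} (c : k) (f : M ⟶ N) :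
    Hom.toLin (c • f) = c • f.toLin := rfl

instance : Preadditive (LMod Q) where
  add_comp _ _ _ f f' g := hom_ext (LinearMap.comp_add _ _ _)
  comp_add _ _ _ f g g' := hom_ext (LinearMap.add_comp _ _ _)

instance : Linear k (LMod Q) where
  smul_comp _ _ _ c f g := hom_ext (LinearMap.comp_smul _ _ _)
  comp_smul _ _ _ f c g := hom_ext (LinearMap.smul_comp _ _ _)

/-- An `H`-linear isomorphism of vector spaces is an isomorphism of modules. -/
def isoOfLinearEquiv {M N : LMod Q} (e : M.carrier ≃ₗ[k] N.carrier)
    (he : ∀ h m, e (M.act h m) = N.act h (e m)) : M ≅ N where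
  hom := ⟨e.toLinearMap, he⟩
  inv := ⟨e.symm.toLinearMap, fun h n => by
    apply e.injective
    simp [he]⟩
  hom_inv_id := by ext; simp
  inv_hom_id := by ext; simp

/-- The tensor product of two modules: `H` acts on `M ⊗ N` through `Δ`. -/
def tensor (M N : LMod Q) : LMod Q where
  carrier := M.carrier ⊗[k] N.carrier
  act := (boxAct M.act N.act).comp Q.comul

/-- The trivial module: `H` acts on `k` through `ε`. -/
def unit (Q : QuasiBialgebra k H) : LMod Q where
  carrier := k
  act := (Algebra.lsmul k k k).comp Q.counit

/-- The tensor product of two `H`-linear maps. -/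
def tensorMap {M N M' N' : LMod Q} (f : M ⟶ M') (g : N ⟶ N') : tensor M N ⟶ tensor M' N' where
  toLin := TensorProduct.map f.toLin g.toLin
  map_act h m := boxAct_intertwine f.toLin g.toLin f.map_act g.map_act (Q.comul h) m

/-- The associativity constraint
`(M ⊗ N) ⊗ P → M ⊗ (N ⊗ P)`, `(m ⊗ n) ⊗ p ↦ Φ · (m ⊗ (n ⊗ p))`. -/
def assocIso (M N P : LMod Q) : tensor (tensor M N) P ≅ tensor M (tensor N P) :=
  isoOfLinearEquiv
    ((TensorProduct.assoc k M.carrier N.carrier P.carrier).trans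
      (LinearMap.GeneralLinearGroup.toLinearEquiv
        (Units.map (boxAct M.act (boxAct N.act P.act)).toMonoidHom Q.Phi)))
    (fun h (m : (M.carrier ⊗[k] N.carrier) ⊗[k] P.carrier) => by
      change boxAct M.act (boxAct N.act P.act) (Q.Phi : H ⊗[k] (H ⊗[k] H))
          (TensorProduct.assoc k M.carrier N.carrier P.carrier
            (boxAct ((boxAct M.act N.act).comp Q.comul) P.act (Q.comul h) m)) =
        boxAct M.act ((boxAct N.act P.act).comp Q.comul) (Q.comul h)
          (boxAct M.act (boxAct N.act P.act) (Q.Phi : H ⊗[k] (H ⊗[k] H))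
            (TensorProduct.assoc k M.carrier N.carrier P.carrier m))
      have h1 := boxAct_map (boxAct M.act N.act) P.act Q.comul (AlgHom.id k H) (Q.comul h)
      have h2 := boxAct_map M.act (boxAct N.act P.act) (AlgHom.id k H) Q.comul (Q.comul h)
      rw [AlgHom.comp_id] at h1 h2
      rw [← h1, ← h2, boxAct_assoc, ← Module.End.mul_apply, ← Module.End.mul_apply, ← map_mul,
        ← map_mul, Q.Phi_comul])

/-- The left unit constraint `k ⊗ M → M`, `c ⊗ m ↦ c m`. -/
def leftUnitIso (M : LMod Q) : tensor (unit Q) M ≅ M :=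
  isoOfLinearEquiv (TensorProduct.lid k M.carrier) (fun h (m : k ⊗[k] M.carrier) => by
    have key : ∀ (x : H ⊗[k] H) (m : k ⊗[k] M.carrier),
        TensorProduct.lid k M.carrier
          (boxAct ((Algebra.lsmul k k k).comp Q.counit) M.act x m) =
        M.act (Algebra.TensorProduct.lid k H
          (Algebra.TensorProduct.map Q.counit (AlgHom.id k H) x))
          (TensorProduct.lid k M.carrier m) := by
      intro x m
      induction x with
      | zero => simp
      | add x y hx hy => simp [hx, hy]
      | tmul a b =>
        induction m with
        | zero => simp
        | add x y hx hy => simp only [map_add, hx, hy]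
        | tmul c v =>
          simp only [boxAct_tmul, TensorProduct.map_tmul, AlgHom.comp_apply, Algebra.lsmul_coe,
            TensorProduct.lid_tmul, Algebra.TensorProduct.map_tmul,
            Algebra.TensorProduct.lid_tmul, AlgHom.id_apply,
            map_smul, LinearMap.smul_apply, smul_smul, smul_eq_mul, mul_comm]
    exact (key (Q.comul h) m).trans (congrArg (fun y => M.act y _) (Q.counit_comul h)))

/-- The right unit constraint `M ⊗ k → M`, `m ⊗ c ↦ c m`. -/
def rightUnitIso (M : LMod Q) : tensor M (unit Q) ≅ M :=
  isoOfLinearEquiv (TensorProduct.rid k M.carrier) (fun h (m : M.carrier ⊗[k] k) => by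
    have key : ∀ (x : H ⊗[k] H) (m : M.carrier ⊗[k] k),
        TensorProduct.rid k M.carrier
          (boxAct M.act ((Algebra.lsmul k k k).comp Q.counit) x m) =
        M.act (Algebra.TensorProduct.rid k k H
          (Algebra.TensorProduct.map (AlgHom.id k H) Q.counit x))
          (TensorProduct.rid k M.carrier m) := by
      intro x m
      induction x with
      | zero => simp
      | add x y hx hy => simp [hx, hy]
      | tmul a b =>
        induction m with
        | zero => simp
        | add x y hx hy => simp only [map_add, hx, hy]
        | tmul c v =>
          simp only [boxAct_tmul, TensorProduct.map_tmul, AlgHom.comp_apply, Algebra.lsmul_coe,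
            TensorProduct.rid_tmul, Algebra.TensorProduct.map_tmul,
            Algebra.TensorProduct.rid_tmul, AlgHom.id_apply,
            map_smul, LinearMap.smul_apply, smul_smul, smul_eq_mul, mul_comm]
    exact (key (Q.comul h) m).trans (congrArg (fun y => M.act y _) (Q.comul_counit h)))

instance : MonoidalCategoryStruct (LMod Q) where
  tensorObj := tensor
  whiskerLeft M _ _ f := tensorMap (𝟙 M) f
  whiskerRight f N := tensorMap f (𝟙 N)
  tensorHom f g := tensorMap f g
  tensorUnit := unit Q
  associator := assocIso
  leftUnitor := leftUnitIso
  rightUnitor := rightUnitIso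

theorem assoc_toLin (M N P : LMod Q) (v : (M.carrier ⊗[k] N.carrier) ⊗[k] P.carrier) :
    (assocIso M N P).hom.toLin v = boxAct M.act (boxAct N.act P.act)
      (Q.Phi : H ⊗[k] (H ⊗[k] H)) (TensorProduct.assoc k _ _ _ v) := rfl

theorem tensorMap_comp {M N P M' N' P' : LMod Q} (f : M ⟶ N) (f' : M' ⟶ N') (g : N ⟶ P)
    (g' : N' ⟶ P') : tensorMap f f' ≫ tensorMap g g' = tensorMap (f ≫ g) (f' ≫ g') :=
  hom_ext (TensorProduct.map_comp _ _ _ _).symm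

theorem tensorMap_id (M N : LMod Q) : tensorMap (𝟙 M) (𝟙 N) = 𝟙 (tensor M N) :=
  hom_ext TensorProduct.map_id

theorem assoc_naturality {M N P M' N' P' : LMod Q} (f : M ⟶ M') (g : N ⟶ N') (h : P ⟶ P') :
    tensorMap (tensorMap f g) h ≫ (assocIso M' N' P').hom =
      (assocIso M N P).hom ≫ tensorMap f (tensorMap g h) := by
  apply hom_ext
  apply LinearMap.ext
  intro v
  change boxAct M'.act (boxAct N'.act P'.act) (Q.Phi : H ⊗[k] (H ⊗[k] H))
      (TensorProduct.assoc k _ _ _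
        (TensorProduct.map (TensorProduct.map f.toLin g.toLin) h.toLin v)) =
    TensorProduct.map f.toLin (TensorProduct.map g.toLin h.toLin)
      (boxAct M.act (boxAct N.act P.act) (Q.Phi : H ⊗[k] (H ⊗[k] H))
        (TensorProduct.assoc k _ _ _ v))
  rw [boxAct_intertwine (r' := M'.act) (s' := boxAct N'.act P'.act) f.toLin
    (TensorProduct.map g.toLin h.toLin) f.map_act
    (boxAct_intertwine g.toLin h.toLin g.map_act h.map_act)]
  congr 1
  have : (TensorProduct.assoc k M'.carrier N'.carrier P'.carrier).toLinearMap ∘ₗ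
        TensorProduct.map (TensorProduct.map f.toLin g.toLin) h.toLin =
      TensorProduct.map f.toLin (TensorProduct.map g.toLin h.toLin) ∘ₗ
        (TensorProduct.assoc k M.carrier N.carrier P.carrier).toLinearMap := by
    ext
    simp
  exact LinearMap.congr_fun this v

theorem triangle_aux (M N : LMod Q) :
    (assocIso M (unit Q) N).hom ≫ tensorMap (𝟙 M) (leftUnitIso N).hom =
      tensorMap (rightUnitIso M).hom (𝟙 N) := by
  apply hom_ext
  apply LinearMap.ext
  intro v
  change TensorProduct.map LinearMap.id (TensorProduct.lid k N.carrier).toLinearMap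
      (boxAct M.act (boxAct ((Algebra.lsmul k k k).comp Q.counit) N.act)
        (Q.Phi : H ⊗[k] (H ⊗[k] H)) (TensorProduct.assoc k M.carrier k N.carrier v)) =
    TensorProduct.map (TensorProduct.rid k M.carrier).toLinearMap LinearMap.id v
  have key : ∀ (x : H ⊗[k] (H ⊗[k] H)),
      TensorProduct.map LinearMap.id (TensorProduct.lid k N.carrier).toLinearMap ∘ₗ
        (boxAct M.act (boxAct ((Algebra.lsmul k k k).comp Q.counit) N.act) x) ∘ₗ
          (TensorProduct.assoc k M.carrier k N.carrier).toLinearMap =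
      boxAct M.act N.act (Algebra.TensorProduct.map (AlgHom.id k H)
        ((Algebra.TensorProduct.lid k H).toAlgHom.comp
          (Algebra.TensorProduct.map Q.counit (AlgHom.id k H))) x) ∘ₗ
        TensorProduct.map (TensorProduct.rid k M.carrier).toLinearMap LinearMap.id := by
    intro x
    induction x with
    | zero => simp
    | add x y hx hy => simp only [map_add, LinearMap.comp_add, LinearMap.add_comp, hx, hy]
    | tmul a y =>
      induction y with
      | zero => simp
      | add x y hx hy =>
        simp only [TensorProduct.tmul_add, map_add, LinearMap.comp_add, LinearMap.add_comp, hx, hy]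
      | tmul b c =>
        ext m n
        simp
  have h := LinearMap.congr_fun (key (Q.Phi : H ⊗[k] (H ⊗[k] H))) v
  rw [Q.counit_Phi, map_one] at h
  exact h

theorem pentagon_aux (M N P R : LMod Q) :
    tensorMap (assocIso M N P).hom (𝟙 R) ≫ (assocIso M (tensor N P) R).hom ≫
        tensorMap (𝟙 M) (assocIso N P R).hom =
      (assocIso (tensor M N) P R).hom ≫ (assocIso M N (tensor P R)).hom := by
  apply hom_ext
  apply LinearMap.ext
  intro (v : ((M.carrier ⊗[k] N.carrier) ⊗[k] P.carrier) ⊗[k] R.carrier)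
  change TensorProduct.map LinearMap.id
      (boxAct N.act (boxAct P.act R.act) (Q.Phi : H ⊗[k] (H ⊗[k] H)) ∘ₗ
        (TensorProduct.assoc k N.carrier P.carrier R.carrier).toLinearMap)
      (boxAct M.act (boxAct ((boxAct N.act P.act).comp Q.comul) R.act)
        (Q.Phi : H ⊗[k] (H ⊗[k] H))
        (TensorProduct.assoc k M.carrier (N.carrier ⊗[k] P.carrier) R.carrier
          (TensorProduct.map
            (boxAct M.act (boxAct N.act P.act) (Q.Phi : H ⊗[k] (H ⊗[k] H)) ∘ₗ
              (TensorProduct.assoc k M.carrier N.carrier P.carrier).toLinearMap)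
            LinearMap.id v))) =
    boxAct M.act (boxAct N.act ((boxAct P.act R.act).comp Q.comul))
      (Q.Phi : H ⊗[k] (H ⊗[k] H))
      (TensorProduct.assoc k M.carrier N.carrier (P.carrier ⊗[k] R.carrier)
        (boxAct ((boxAct M.act N.act).comp Q.comul) (boxAct P.act R.act)
          (Q.Phi : H ⊗[k] (H ⊗[k] H))
          (TensorProduct.assoc k (M.carrier ⊗[k] N.carrier) P.carrier R.carrier v)))
  -- The right-hand side: move both linear reassociations to the right.
  have hR1 : ∀ x : H ⊗[k] (H ⊗[k] H),
      boxAct ((boxAct M.act N.act).comp Q.comul) (boxAct P.act R.act) x =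
        boxAct (boxAct M.act N.act) (boxAct P.act R.act)
          (Algebra.TensorProduct.map Q.comul (AlgHom.id k (H ⊗[k] H)) x) := by
    intro x
    rw [boxAct_map, AlgHom.comp_id]
  have hR2 : ∀ x : H ⊗[k] (H ⊗[k] H),
      boxAct M.act (boxAct N.act ((boxAct P.act R.act).comp Q.comul)) x =
        boxAct M.act (boxAct N.act (boxAct P.act R.act))
          (Algebra.TensorProduct.map (AlgHom.id k H)
            (Algebra.TensorProduct.map (AlgHom.id k H) Q.comul) x) := by
    intro x
    rw [boxAct_map, AlgHom.comp_id]
    congr 1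
    ext y <;> simp
  rw [hR1, hR2, boxAct_assoc, ← Module.End.mul_apply, ← map_mul, Q.pentagon]
  -- The left-hand side.
  have hL1 : ∀ w, TensorProduct.map LinearMap.id
      (boxAct N.act (boxAct P.act R.act) (Q.Phi : H ⊗[k] (H ⊗[k] H)) ∘ₗ
        (TensorProduct.assoc k N.carrier P.carrier R.carrier).toLinearMap) w =
      boxAct M.act (boxAct N.act (boxAct P.act R.act))
        ((1 : H) ⊗ₜ[k] (Q.Phi : H ⊗[k] (H ⊗[k] H)))
        (TensorProduct.map LinearMap.id
          (TensorProduct.assoc k N.carrier P.carrier R.carrier).toLinearMap w) := by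
    intro w
    rw [boxAct_tmul, map_one, ← LinearMap.comp_apply, ← TensorProduct.map_comp]
    rfl
  have hL2 : ∀ (x : H ⊗[k] (H ⊗[k] H)) w, TensorProduct.map LinearMap.id
      (TensorProduct.assoc k N.carrier P.carrier R.carrier).toLinearMap
      (boxAct M.act (boxAct ((boxAct N.act P.act).comp Q.comul) R.act) x w) =
      boxAct M.act (boxAct N.act (boxAct P.act R.act))
        (Algebra.TensorProduct.map (AlgHom.id k H)
          ((Algebra.TensorProduct.assoc k k k H H H).toAlgHom.comp
            (Algebra.TensorProduct.map Q.comul (AlgHom.id k H))) x)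
        (TensorProduct.map LinearMap.id
          (TensorProduct.assoc k N.carrier P.carrier R.carrier).toLinearMap w) := by
    intro x w
    rw [boxAct_map, AlgHom.comp_id]
    refine boxAct_intertwine _ _ (fun _ _ => rfl) (fun b v => ?_) x w
    have := boxAct_map (boxAct N.act P.act) R.act Q.comul (AlgHom.id k H) b
    rw [AlgHom.comp_id] at this
    rw [← this]
    exact boxAct_assoc _ _ _ _ _
  have hL3 : ∀ (x : H ⊗[k] (H ⊗[k] H)) (w : (M.carrier ⊗[k] (N.carrier ⊗[k] P.carrier)) ⊗[k]
      R.carrier),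
      TensorProduct.map LinearMap.id
        (TensorProduct.assoc k N.carrier P.carrier R.carrier).toLinearMap
        (TensorProduct.assoc k M.carrier (N.carrier ⊗[k] P.carrier) R.carrier
          (TensorProduct.map (boxAct M.act (boxAct N.act P.act) x) LinearMap.id w)) =
      boxAct M.act (boxAct N.act (boxAct P.act R.act))
        (Algebra.TensorProduct.map (AlgHom.id k H)
          (Algebra.TensorProduct.map (AlgHom.id k H)
            (Algebra.TensorProduct.includeLeft : H →ₐ[k] H ⊗[k] H)) x)
        (TensorProduct.map LinearMap.id
          (TensorProduct.assoc k N.carrier P.carrier R.carrier).toLinearMap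
          (TensorProduct.assoc k M.carrier (N.carrier ⊗[k] P.carrier) R.carrier w)) := by
    intro x w
    have : TensorProduct.map LinearMap.id
          (TensorProduct.assoc k N.carrier P.carrier R.carrier).toLinearMap ∘ₗ
        (TensorProduct.assoc k M.carrier (N.carrier ⊗[k] P.carrier) R.carrier).toLinearMap ∘ₗ
          TensorProduct.map (boxAct M.act (boxAct N.act P.act) x) LinearMap.id =
      boxAct M.act (boxAct N.act (boxAct P.act R.act))
        (Algebra.TensorProduct.map (AlgHom.id k H)
          (Algebra.TensorProduct.map (AlgHom.id k H)
            (Algebra.TensorProduct.includeLeft : H →ₐ[k] H ⊗[k] H)) x) ∘ₗ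
        TensorProduct.map LinearMap.id
          (TensorProduct.assoc k N.carrier P.carrier R.carrier).toLinearMap ∘ₗ
          (TensorProduct.assoc k M.carrier (N.carrier ⊗[k] P.carrier) R.carrier).toLinearMap := by
      induction x with
      | zero => simp
      | add x y hx hy =>
        simp only [map_add, LinearMap.comp_add, LinearMap.add_comp, hx, hy,
          TensorProduct.map_add_left]
      | tmul a y =>
        induction y with
        | zero => simp
        | add x y hx hy =>
          simp only [TensorProduct.tmul_add, map_add, LinearMap.comp_add, LinearMap.add_comp,
            hx, hy, TensorProduct.map_add_left]
        | tmul b c =>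
          ext m n p r
          simp
    exact LinearMap.congr_fun this w
  have hL4 : TensorProduct.map
      (boxAct M.act (boxAct N.act P.act) (Q.Phi : H ⊗[k] (H ⊗[k] H)) ∘ₗ
        (TensorProduct.assoc k M.carrier N.carrier P.carrier).toLinearMap)
      LinearMap.id v =
      TensorProduct.map (boxAct M.act (boxAct N.act P.act) (Q.Phi : H ⊗[k] (H ⊗[k] H)))
        (LinearMap.id : R.carrier →ₗ[k] R.carrier)
        (TensorProduct.map (TensorProduct.assoc k M.carrier N.carrier P.carrier).toLinearMap
          LinearMap.id v) := by
    rw [← LinearMap.comp_apply, ← TensorProduct.map_comp, LinearMap.id_comp]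
  have hlin : TensorProduct.map LinearMap.id
        (TensorProduct.assoc k N.carrier P.carrier R.carrier).toLinearMap ∘ₗ
      (TensorProduct.assoc k M.carrier (N.carrier ⊗[k] P.carrier) R.carrier).toLinearMap ∘ₗ
        TensorProduct.map (TensorProduct.assoc k M.carrier N.carrier P.carrier).toLinearMap
          LinearMap.id =
      (TensorProduct.assoc k M.carrier N.carrier (P.carrier ⊗[k] R.carrier)).toLinearMap ∘ₗ
        (TensorProduct.assoc k (M.carrier ⊗[k] N.carrier) P.carrier R.carrier).toLinearMap := by
    ext
    simp
  rw [hL1, hL2, hL4, hL3, map_mul, map_mul, Module.End.mul_apply, Module.End.mul_apply]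
  exact congrArg _ (congrArg _ (congrArg _ (LinearMap.congr_fun hlin v)))

/-- The category of left modules over a quasi-bialgebra is monoidal. -/
instance : MonoidalCategory (LMod Q) where
  tensorHom_def f g := by
    change tensorMap f g = tensorMap f (𝟙 _) ≫ tensorMap (𝟙 _) g
    rw [tensorMap_comp, Category.comp_id, Category.id_comp]
  id_tensorHom_id M N := tensorMap_id M N
  tensorHom_comp_tensorHom f f' g g' := tensorMap_comp f f' g g'
  whiskerLeft_id M N := tensorMap_id M N
  id_whiskerRight M N := tensorMap_id M N
  associator_naturality f g h := assoc_naturality f g h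
  leftUnitor_naturality f := by
    apply hom_ext
    change (TensorProduct.lid k _).toLinearMap ∘ₗ TensorProduct.map LinearMap.id f.toLin =
      f.toLin ∘ₗ (TensorProduct.lid k _).toLinearMap
    ext
    simp
  rightUnitor_naturality f := by
    apply hom_ext
    change (TensorProduct.rid k _).toLinearMap ∘ₗ TensorProduct.map f.toLin LinearMap.id =
      f.toLin ∘ₗ (TensorProduct.rid k _).toLinearMap
    ext
    simp
  pentagon M N P R := pentagon_aux M N P R
  triangle M N := triangle_aux M N

end LMod

/-! ## The normalized two-sided integral -/

/-- `x` is a two-sided integral with `ε(x) = 1`. -/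
structure IsNormalizedIntegral (Q : QuasiBialgebra k H) (x : H) : Prop where
  left (h : H) : h * x = Q.counit h • x
  right (h : H) : x * h = Q.counit h • x
  counit_eq_one : Q.counit x = 1

theorem exists_left_integral (Q : QuasiBialgebra k H) [IsSemisimpleRing H] :
    ∃ x : H, (∀ h : H, h * x = Q.counit h • x) ∧ Q.counit x = 1 := by
  obtain ⟨L, hL⟩ := exists_isCompl (RingHom.ker Q.counit : Submodule H H)
  have h1 : (1 : H) ∈ (RingHom.ker Q.counit : Submodule H H) ⊔ L := by
    rw [hL.sup_eq_top]; trivial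
  obtain ⟨a, ha, e, he, hae⟩ := Submodule.mem_sup.mp h1
  have hker : ∀ h : H, Q.counit h = 0 → h * e = 0 := by
    intro h hh
    have m1 : h * e ∈ (RingHom.ker Q.counit : Submodule H H) := by
      change Q.counit (h * e) = 0
      rw [map_mul, hh, zero_mul]
    have m2 : h * e ∈ L := L.smul_mem h he
    have := Submodule.mem_inf.mpr ⟨m1, m2⟩
    rwa [hL.inf_eq_bot, Submodule.mem_bot] at this
  refine ⟨e, fun h => ?_, ?_⟩
  · have := hker (h - algebraMap k H (Q.counit h)) (by simp)
    rw [sub_mul, sub_eq_zero] at this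
    rw [this, Algebra.smul_def]
  · have ha' : Q.counit a = 0 := ha
    have := congrArg Q.counit hae
    rwa [map_add, ha', zero_add, map_one] at this

theorem exists_isNormalizedIntegral (Q : QuasiBialgebra k H) [IsSemisimpleRing H] :
    ∃ x : H, Q.IsNormalizedIntegral x := by
  obtain ⟨e, he, he1⟩ := Q.exists_left_integral
  -- A two-sided ideal of square zero in a semisimple ring vanishes: apply this to `e * ker ε`.
  have key : ∀ x : H, Q.counit x = 0 → e * x = 0 := by
    intro x hx
    have hex : (e * x) * e = 0 := by rw [mul_assoc, he x, hx, zero_smul, mul_zero]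
    obtain ⟨L, hL⟩ := exists_isCompl (Ideal.span {e * x} : Submodule H H)
    have h1 : (1 : H) ∈ (Ideal.span {e * x} : Submodule H H) ⊔ L := by
      rw [hL.sup_eq_top]; trivial
    obtain ⟨a, ha, b, hb, hab⟩ := Submodule.mem_sup.mp h1
    obtain ⟨c, rfl⟩ := Ideal.mem_span_singleton'.mp ha
    have h2 : (e * x) * (c * (e * x)) = 0 := by
      have : x * (c * e) = 0 := by
        rw [he c, mul_smul_comm, he x, hx, zero_smul, smul_zero]
      rw [mul_assoc, ← mul_assoc c e x, ← mul_assoc x, this, zero_mul, mul_zero]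
    have h3 : (e * x) * b = e * x := by
      have := congrArg (fun y => (e * x) * y) hab
      simpa [mul_add, h2] using this
    have m1 : e * x ∈ (Ideal.span {e * x} : Submodule H H) := Ideal.mem_span_singleton_self _
    have m2 : e * x ∈ L := by
      rw [← h3]
      exact L.smul_mem _ hb
    have := Submodule.mem_inf.mpr ⟨m1, m2⟩
    rwa [hL.inf_eq_bot, Submodule.mem_bot] at this
  refine ⟨e, he, fun h => ?_, he1⟩
  have := key (h - algebraMap k H (Q.counit h)) (by simp)
  rw [mul_sub, sub_eq_zero] at this
  rw [this, Algebra.smul_def, Algebra.commutes]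

theorem IsNormalizedIntegral.unique {Q : QuasiBialgebra k H} {x y : H}
    (hx : Q.IsNormalizedIntegral x) (hy : Q.IsNormalizedIntegral y) : x = y := by
  have h1 := hx.right y
  have h2 := hy.left x
  rw [hy.counit_eq_one, one_smul] at h1
  rw [hx.counit_eq_one, one_smul] at h2
  exact h1.symm.trans h2

/-- The unique normalized two-sided integral `Λ` of a semisimple quasi-bialgebra. -/
def integral (Q : QuasiBialgebra k H) [IsSemisimpleRing H] : H :=
  Q.exists_isNormalizedIntegral.choose

theorem isNormalizedIntegral_integral (Q : QuasiBialgebra k H) [IsSemisimpleRing H] :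
    Q.IsNormalizedIntegral Q.integral :=
  Q.exists_isNormalizedIntegral.choose_spec

end QuasiBialgebra

namespace QuasiHopfAlgebra

variable {k : Type u} [Field k] {H : Type u} [Ring H] [Algebra k H]

/-- `q_L = ∑ S(X') α Y' ⊗ Z'`, where `Φ⁻¹ = ∑ X' ⊗ Y' ⊗ Z'`. -/
def qL (Q : QuasiHopfAlgebra k H) : H ⊗[k] H :=
  TensorProduct.map
    (LinearMap.mul' k H ∘ₗ TensorProduct.map
      (LinearMap.mulRight k Q.alpha ∘ₗ Q.antipode.toLinearMap) LinearMap.id)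
    LinearMap.id
    ((TensorProduct.assoc k H H H).symm
      ((Q.Phi⁻¹ : (H ⊗[k] (H ⊗[k] H))ˣ) : H ⊗[k] (H ⊗[k] H)))

/-- `p_L = ∑ Y S⁻¹(X β) ⊗ Z`, where `Φ = ∑ X ⊗ Y ⊗ Z`. -/
def pL (Q : QuasiHopfAlgebra k H) : H ⊗[k] H :=
  TensorProduct.map
    (LinearMap.mul' k H ∘ₗ TensorProduct.map
        LinearMap.id (Q.antipode.symm.toLinearMap ∘ₗ LinearMap.mulRight k Q.beta) ∘ₗ
      (TensorProduct.comm k H H).toLinearMap)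
    LinearMap.id
    ((TensorProduct.assoc k H H H).symm (Q.Phi : H ⊗[k] (H ⊗[k] H)))

/-- The element `ν_H = m(q_L Δ(Λ) p_L)`, where `m` is the multiplication `H ⊗ H → H` and `Λ` is
the normalized two-sided integral. -/
def nu (Q : QuasiHopfAlgebra k H) [IsSemisimpleRing H] : H :=
  LinearMap.mul' k H (Q.qL * Q.comul Q.toQuasiBialgebra.integral * Q.pL)

end QuasiHopfAlgebra

/-- `Irr(H)`: the set of characters of irreducible (that is, simple) left `H`-modules. -/
def IrrChar (k : Type u) [Field k] (H : Type u) [Ring H] [Algebra k H] : Set (H →ₗ[k] k) :=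
  {χ | ∃ (M : Type u) (_ : AddCommGroup M) (_ : Module k M) (_ : Module H M)
      (_ : IsScalarTower k H M), IsSimpleModule H M ∧
      χ = LinearMap.trace k M ∘ₗ (Algebra.lsmul k k M : H →ₐ[k] Module.End k M).toLinearMap}

end

/-! The indicator of an irreducible module `V` is expressed through data that a tensor equivalence
preserves. An invariant vector is a morphism `t : 𝟙 ⟶ V ⊗ V`. If only `t = 0` exists, `Δ(Λ)` acts on
`V ⊗ V` by zero, since its image consists of invariants, and the indicator vanishes. Otherwise
averaging a functional with `Λ` gives `g : V ⊗ V ⟶ 𝟙` with `t ≫ g = 𝟙`. The zigzag `V ≅ 𝟙 ⊗ V → (V ⊗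
V) ⊗ V → V ⊗ (V ⊗ V) → V ⊗ 𝟙 ≅ V` of `t` and `g` is a scalar `μ`, and the indicator is `μ · dim V`
(`QuasiHopfAlgebra.trace_nu_eq`).

To see this, note that by Schur's lemma invariant vectors and forms are unique up to scalars, so
`Δ(Λ)` acts on `V ⊗ V` as the rank one operator `x ↦ g(x) t`. Since `tr(m(x))` on `V` is the trace
of the flip composed with `x` on `V ⊗ V`, the indicator is `g(p_L · τ(q_L t))`, with `τ` the flip.
This is the trace of the composite `V → V* → V` whose first map comes from `g` and `p_L` and whose
second comes from `q_L t`. The elements `p_L` and `q_L` are built so that these maps are `H`-linear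
up to the antipode; the composite is therefore a scalar `c`, with trace `c · dim V`.

That `c = μ` is the role of the pentagon. A linear map on `H ⊗ H ⊗ H ⊗ H` that absorbs coproducts in
the right places takes the same value at `1 ⊗ Φ` and at `Φ⁻¹ ⊗ 1` (`eq_of_absorbs_comul`). Used
twice, in `snake_alpha` and `form_eq_flipForm_pL`, this compares the two scalars after acting by
`α`, and `α` acts nontrivially.

A strong monoidal functor carries a zigzag to a zigzag, so `μ` is preserved. Dimensions are
preserved although no fibre functor is: comparing Hom spaces out of the regular modules bounds `dim
M` and `dim F(M)` by constant multiples of each other, and applying this to all tensor powers forces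
equality (`finrank_obj`). The bijection on characters exists because irreducibles are exactly the
nonzero modules with scalar endomorphisms, a condition visible to a linear equivalence, and because
their characters determine them. -/

noncomputable section

set_option maxSynthPendingDepth 8

/-! ### Counit identities for the associator and a consequence of the pentagon -/

namespace QuasiBialgebra

variable {k : Type u} [Field k] {H : Type u} [Ring H] [Algebra k H]

/-- Apply the counit to the left factor. -/
def counitLeft (Q : QuasiBialgebra k H) (A : Type u) [Ring A] [Algebra k A] : H ⊗[k] A →ₐ[k] A :=
  (Algebra.TensorProduct.lid k A).toAlgHom.comp (Algebra.TensorProduct.map Q.counit (AlgHom.id k A))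

/-- Apply the counit to the right factor. -/
def counitRight (Q : QuasiBialgebra k H) (A : Type u) [Ring A] [Algebra k A] : A ⊗[k] H →ₐ[k] A :=
  (Algebra.TensorProduct.rid k k A).toAlgHom.comp
    (Algebra.TensorProduct.map (AlgHom.id k A) Q.counit)

@[simp]
theorem counitLeft_tmul (Q : QuasiBialgebra k H) {A : Type u} [Ring A] [Algebra k A] (h : H)
    (a : A) : Q.counitLeft A (h ⊗ₜ a) = Q.counit h • a := by
  simp [counitLeft]

@[simp]
theorem counitRight_tmul (Q : QuasiBialgebra k H) {A : Type u} [Ring A] [Algebra k A] (h : H)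
    (a : A) : Q.counitRight A (a ⊗ₜ h) = Q.counit h • a := by
  simp [counitRight]

theorem counit_Phi' (Q : QuasiBialgebra k H) :
    Algebra.TensorProduct.map (AlgHom.id k H) (Q.counitLeft H)
      (Q.Phi : H ⊗[k] (H ⊗[k] H)) = 1 :=
  Q.counit_Phi

theorem map_counitLeft_assoc (Q : QuasiBialgebra k H) {A : Type u} [Ring A] [Algebra k A]
    (x : H ⊗[k] H) (a : A) :
    Algebra.TensorProduct.map (AlgHom.id k H) (Q.counitLeft A)
      (Algebra.TensorProduct.assoc k k k H H A (x ⊗ₜ a)) = Q.counitRight H x ⊗ₜ a := by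
  induction x with
  | zero => simp
  | add x y hx hy => simp only [map_add, TensorProduct.add_tmul, hx, hy]
  | tmul b c => simp [TensorProduct.smul_tmul]

theorem counitLeft_assoc (Q : QuasiBialgebra k H) {A B : Type u} [Ring A] [Algebra k A] [Ring B]
    [Algebra k B] (x : H ⊗[k] A) (b : B) :
    Q.counitLeft (A ⊗[k] B) (Algebra.TensorProduct.assoc k k k H A B (x ⊗ₜ b)) =
      Q.counitLeft A x ⊗ₜ b := by
  induction x with
  | zero => simp
  | add x y hx hy => simp only [map_add, TensorProduct.add_tmul, hx, hy]
  | tmul b c => simp [TensorProduct.smul_tmul']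

@[simp]
theorem counitLeft_comul (Q : QuasiBialgebra k H) (h : H) : Q.counitLeft H (Q.comul h) = h :=
  Q.counit_comul h

@[simp]
theorem counitRight_comul (Q : QuasiBialgebra k H) (h : H) : Q.counitRight H (Q.comul h) = h :=
  Q.comul_counit h

/-- Induction on an element of a triple tensor product. -/
@[elab_as_elim]
theorem _root_.TensorProduct.induction_three {A B C : Type u} [AddCommGroup A] [Module k A]
    [AddCommGroup B] [Module k B] [AddCommGroup C] [Module k C]
    {p : A ⊗[k] (B ⊗[k] C) → Prop} (x : A ⊗[k] (B ⊗[k] C)) (zero : p 0)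
    (add : ∀ x y, p x → p y → p (x + y)) (tmul : ∀ a b c, p (a ⊗ₜ (b ⊗ₜ c))) : p x := by
  induction x with
  | zero => exact zero
  | add x y hx hy => exact add x y hx hy
  | tmul a y =>
    induction y with
    | zero => rwa [TensorProduct.tmul_zero]
    | add x y hx hy => rw [TensorProduct.tmul_add]; exact add _ _ hx hy
    | tmul b c => exact tmul a b c

/-- `(id ⊗ id ⊗ ε)(Φ) = 1`. -/
theorem counitRight_Phi (Q : QuasiBialgebra k H) :
    Algebra.TensorProduct.map (AlgHom.id k H) (Q.counitRight H)
      (Q.Phi : H ⊗[k] (H ⊗[k] H)) = 1 := by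
  -- Applying `ε` in the third of the four slots reduces the pentagon to `Φ = Φ · ((id ⊗ id ⊗ ε)(Φ)
  -- ⊗ 1)`, and `Φ` cancels.
  have h := congrArg (Algebra.TensorProduct.map (AlgHom.id k H)
    (Algebra.TensorProduct.map (AlgHom.id k H) (Q.counitLeft H))) Q.pentagon
  simp only [map_mul] at h
  have hA : ∀ x : H ⊗[k] (H ⊗[k] H), Algebra.TensorProduct.map (AlgHom.id k H)
      (Algebra.TensorProduct.map (AlgHom.id k H) (Q.counitLeft H))
      (Algebra.TensorProduct.map (AlgHom.id k H)
          (Algebra.TensorProduct.map (AlgHom.id k H) Q.comul) x) = x := fun x => by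
    induction x using TensorProduct.induction_three with
    | zero => simp
    | add x y hx hy => simp only [map_add, hx, hy]
    | tmul a b c => simp
  have hB : ∀ x : H ⊗[k] (H ⊗[k] H), Algebra.TensorProduct.map (AlgHom.id k H)
      (Algebra.TensorProduct.map (AlgHom.id k H) (Q.counitLeft H))
      (Algebra.TensorProduct.assoc k k k H H (H ⊗[k] H)
        (Algebra.TensorProduct.map Q.comul (AlgHom.id k (H ⊗[k] H)) x)) =
      Algebra.TensorProduct.assoc k k k H H H
        (Algebra.TensorProduct.map Q.comul (AlgHom.id k H)
          (Algebra.TensorProduct.map (AlgHom.id k H) (Q.counitLeft H) x)) := fun x => by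
    induction x with
    | zero => simp
    | add x y hx hy => simp only [map_add, hx, hy]
    | tmul a y =>
      simp only [Algebra.TensorProduct.map_tmul, AlgHom.id_apply]
      induction Q.comul a with
      | zero => simp
      | add x y hx hy => simp only [map_add, TensorProduct.add_tmul, hx, hy]
      | tmul b c => simp
  have hC : ∀ x : H ⊗[k] (H ⊗[k] H), Algebra.TensorProduct.map (AlgHom.id k H)
      (Algebra.TensorProduct.map (AlgHom.id k H) (Q.counitLeft H))
      (Algebra.TensorProduct.map (AlgHom.id k H)
          ((Algebra.TensorProduct.assoc k k k H H H).toAlgHom.comp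
            (Algebra.TensorProduct.map Q.comul (AlgHom.id k H))) x) = x := fun x => by
    induction x using TensorProduct.induction_three with
    | zero => simp
    | add x y hx hy => simp only [map_add, hx, hy]
    | tmul a b c => simpa using congrArg (fun z => a ⊗ₜ[k] z) (Q.map_counitLeft_assoc (Q.comul b) c)
  have hD : ∀ x : H ⊗[k] (H ⊗[k] H), Algebra.TensorProduct.map (AlgHom.id k H)
      (Algebra.TensorProduct.map (AlgHom.id k H) (Q.counitLeft H))
      (Algebra.TensorProduct.map (AlgHom.id k H)
          (Algebra.TensorProduct.map (AlgHom.id k H)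
            (Algebra.TensorProduct.includeLeft : H →ₐ[k] H ⊗[k] H)) x) =
      Algebra.TensorProduct.map (AlgHom.id k H)
            (Algebra.TensorProduct.includeLeft : H →ₐ[k] H ⊗[k] H)
        (Algebra.TensorProduct.map (AlgHom.id k H) (Q.counitRight H) x) := fun x => by
    induction x using TensorProduct.induction_three with
    | zero => simp
    | add x y hx hy => simp only [map_add, hx, hy]
    | tmul a b c => simp [← TensorProduct.tmul_smul]
  rw [hA, hB, hC, hD, Q.counit_Phi', map_one, map_one, Algebra.TensorProduct.map_tmul,
    Q.counit_Phi', map_one, ← Algebra.TensorProduct.one_def, one_mul, mul_one] at h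
  have h2 : Algebra.TensorProduct.map (AlgHom.id k H)
      (Algebra.TensorProduct.includeLeft : H →ₐ[k] H ⊗[k] H)
        (Algebra.TensorProduct.map (AlgHom.id k H) (Q.counitRight H)
          (Q.Phi : H ⊗[k] (H ⊗[k] H))) = 1 := by
    have := congrArg (((Q.Phi⁻¹ : (H ⊗[k] (H ⊗[k] H))ˣ) : H ⊗[k] (H ⊗[k] H)) * ·) h
    simpa [← mul_assoc] using this.symm
  have h3 := congrArg (Algebra.TensorProduct.map (AlgHom.id k H) (Q.counitRight H)) h2
  have h4 : ∀ y : H ⊗[k] H, Algebra.TensorProduct.map (AlgHom.id k H) (Q.counitRight H)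
      (Algebra.TensorProduct.map (AlgHom.id k H)
        (Algebra.TensorProduct.includeLeft : H →ₐ[k] H ⊗[k] H) y) = y := fun y => by
    induction y with
    | zero => simp
    | add x y hx hy => simp only [map_add, hx, hy]
    | tmul a b => simp
  rwa [h4, map_one] at h3

/-- `(ε ⊗ id ⊗ id)(Φ) = 1`. -/
theorem counitLeft_Phi (Q : QuasiBialgebra k H) :
    Q.counitLeft (H ⊗[k] H) (Q.Phi : H ⊗[k] (H ⊗[k] H)) = 1 := by
  -- With `ε` in the second slot the pentagon becomes `Φ = (1 ⊗ (ε ⊗ id ⊗ id)(Φ)) · Φ`.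
  have h := congrArg (Algebra.TensorProduct.map (AlgHom.id k H)
    (Q.counitLeft (H ⊗[k] H))) Q.pentagon
  simp only [map_mul] at h
  have hA : ∀ x : H ⊗[k] (H ⊗[k] H), Algebra.TensorProduct.map (AlgHom.id k H)
      (Q.counitLeft (H ⊗[k] H))
      (Algebra.TensorProduct.map (AlgHom.id k H)
          (Algebra.TensorProduct.map (AlgHom.id k H) Q.comul) x) =
      Algebra.TensorProduct.map (AlgHom.id k H) Q.comul
        (Algebra.TensorProduct.map (AlgHom.id k H) (Q.counitLeft H) x) := fun x => by
    induction x using TensorProduct.induction_three with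
    | zero => simp
    | add x y hx hy => simp only [map_add, hx, hy]
    | tmul a b c => simp
  have hB : ∀ x : H ⊗[k] (H ⊗[k] H), Algebra.TensorProduct.map (AlgHom.id k H)
      (Q.counitLeft (H ⊗[k] H))
      (Algebra.TensorProduct.assoc k k k H H (H ⊗[k] H)
        (Algebra.TensorProduct.map Q.comul (AlgHom.id k (H ⊗[k] H)) x)) = x := fun x => by
    induction x with
    | zero => simp
    | add x y hx hy => simp only [map_add, hx, hy]
    | tmul a y => simp [map_counitLeft_assoc]
  have hC : ∀ x : H ⊗[k] (H ⊗[k] H), Algebra.TensorProduct.map (AlgHom.id k H)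
      (Q.counitLeft (H ⊗[k] H))
      (Algebra.TensorProduct.map (AlgHom.id k H)
          ((Algebra.TensorProduct.assoc k k k H H H).toAlgHom.comp
            (Algebra.TensorProduct.map Q.comul (AlgHom.id k H))) x) = x := fun x => by
    induction x using TensorProduct.induction_three with
    | zero => simp
    | add x y hx hy => simp only [map_add, hx, hy]
    | tmul a b c => simp [counitLeft_assoc]
  have hD : ∀ x : H ⊗[k] (H ⊗[k] H), Algebra.TensorProduct.map (AlgHom.id k H)
      (Q.counitLeft (H ⊗[k] H))
      (Algebra.TensorProduct.map (AlgHom.id k H)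
          (Algebra.TensorProduct.map (AlgHom.id k H)
            (Algebra.TensorProduct.includeLeft : H →ₐ[k] H ⊗[k] H)) x) =
      Algebra.TensorProduct.map (AlgHom.id k H)
            (Algebra.TensorProduct.includeLeft : H →ₐ[k] H ⊗[k] H)
        (Algebra.TensorProduct.map (AlgHom.id k H) (Q.counitLeft H) x) := fun x => by
    induction x using TensorProduct.induction_three with
    | zero => simp
    | add x y hx hy => simp only [map_add, hx, hy]
    | tmul a b c => simp [← TensorProduct.tmul_smul]
  rw [hA, hB, hC, hD, Q.counit_Phi', map_one, map_one, Algebra.TensorProduct.map_tmul,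
    one_mul, mul_one] at h
  have h2 := congrArg (· * ((Q.Phi⁻¹ : (H ⊗[k] (H ⊗[k] H))ˣ) : H ⊗[k] (H ⊗[k] H))) h
  simp only [mul_assoc, Units.mul_inv, mul_one] at h2
  simpa using (congrArg (Q.counitLeft (H ⊗[k] H)) h2).symm

theorem counit_Phi_inv (Q : QuasiBialgebra k H) :
    Algebra.TensorProduct.map (AlgHom.id k H) (Q.counitLeft H)
      ((Q.Phi⁻¹ : (H ⊗[k] (H ⊗[k] H))ˣ) : H ⊗[k] (H ⊗[k] H)) = 1 := by
  have h := congrArg (Algebra.TensorProduct.map (AlgHom.id k H) (Q.counitLeft H)) Q.Phi.mul_inv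
  rwa [map_mul, Q.counit_Phi', one_mul, map_one] at h

/-- The inclusion `x ↦ x ⊗ 1 ⊗ 1` of the first two factors. -/
def leftTwo : H ⊗[k] H →ₐ[k] H ⊗[k] (H ⊗[k] (H ⊗[k] H)) :=
  (Algebra.TensorProduct.assoc k k k H H (H ⊗[k] H)).toAlgHom.comp
    (Algebra.TensorProduct.includeLeft : H ⊗[k] H →ₐ[k] (H ⊗[k] H) ⊗[k] (H ⊗[k] H))

/-- The inclusion `x ↦ 1 ⊗ x ⊗ 1` of the middle two factors. -/
def midTwo : H ⊗[k] H →ₐ[k] H ⊗[k] (H ⊗[k] (H ⊗[k] H)) :=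
  (Algebra.TensorProduct.includeRight : H ⊗[k] (H ⊗[k] H) →ₐ[k] H ⊗[k] (H ⊗[k] (H ⊗[k] H))).comp
    ((Algebra.TensorProduct.assoc k k k H H H).toAlgHom.comp
      (Algebra.TensorProduct.includeLeft : H ⊗[k] H →ₐ[k] (H ⊗[k] H) ⊗[k] H))

/-- The inclusion `x ↦ 1 ⊗ 1 ⊗ x` of the last two factors. -/
def rightTwo : H ⊗[k] H →ₐ[k] H ⊗[k] (H ⊗[k] (H ⊗[k] H)) :=
  (Algebra.TensorProduct.includeRight : H ⊗[k] (H ⊗[k] H) →ₐ[k] H ⊗[k] (H ⊗[k] (H ⊗[k] H))).comp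
    (Algebra.TensorProduct.includeRight : H ⊗[k] H →ₐ[k] H ⊗[k] (H ⊗[k] H))

@[simp]
theorem leftTwo_tmul (a b : H) :
    leftTwo (k := k) (a ⊗ₜ b) = a ⊗ₜ (b ⊗ₜ ((1 : H) ⊗ₜ (1 : H))) := by
  simp [leftTwo, Algebra.TensorProduct.one_def]

@[simp]
theorem midTwo_tmul (a b : H) :
    midTwo (k := k) (a ⊗ₜ b) = (1 : H) ⊗ₜ (a ⊗ₜ (b ⊗ₜ (1 : H))) := by
  simp [midTwo]

@[simp]
theorem rightTwo_apply (x : H ⊗[k] H) :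
    rightTwo (k := k) x = (1 : H) ⊗ₜ ((1 : H) ⊗ₜ x) := by
  simp [rightTwo]

theorem assoc_map_comul_tmul (Q : QuasiBialgebra k H) (a b c : H) :
    ((Algebra.TensorProduct.assoc k k k H H (H ⊗[k] H)).toAlgHom.comp
      (Algebra.TensorProduct.map Q.comul (AlgHom.id k (H ⊗[k] H)))) (a ⊗ₜ[k] (b ⊗ₜ[k] c)) =
    leftTwo (Q.comul a) * rightTwo (b ⊗ₜ[k] c) := by
  simp only [AlgHom.comp_apply, Algebra.TensorProduct.map_tmul, AlgHom.id_apply]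
  induction Q.comul a with
  | zero => simp
  | add x y hx hy => simp only [map_add, TensorProduct.add_tmul, hx, hy, add_mul]
  | tmul u v => simp

theorem map_assoc_map_comul_tmul (Q : QuasiBialgebra k H) (a b c : H) :
    Algebra.TensorProduct.map (AlgHom.id k H)
          ((Algebra.TensorProduct.assoc k k k H H H).toAlgHom.comp
            (Algebra.TensorProduct.map Q.comul (AlgHom.id k H))) (a ⊗ₜ[k] (b ⊗ₜ[k] c)) =
      (a ⊗ₜ[k] ((1 : H) ⊗ₜ[k] ((1 : H) ⊗ₜ[k] c))) * midTwo (Q.comul b) := by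
  simp only [AlgHom.comp_apply, Algebra.TensorProduct.map_tmul, AlgHom.id_apply]
  induction Q.comul b with
  | zero => simp
  | add x y hx hy =>
    simp only [map_add, TensorProduct.add_tmul, TensorProduct.tmul_add, hx, hy, mul_add]
  | tmul u v => simp

/-- A linear map on `H ⊗ H ⊗ H ⊗ H` that absorbs `1 ⊗ 1 ⊗ Δ(h)` and `Δ(h) ⊗ 1 ⊗ 1` on the left
and `1 ⊗ Δ(h) ⊗ 1` on the right takes the same value at `1 ⊗ Φ` and `Φ⁻¹ ⊗ 1`. -/
theorem eq_of_absorbs_comul (Q : QuasiBialgebra k H) {M : Type u} [AddCommGroup M] [Module k M]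
    (L : H ⊗[k] (H ⊗[k] (H ⊗[k] H)) →ₗ[k] M)
    (h1 : ∀ h y, L (rightTwo (Q.comul h) * y) = Q.counit h • L y)
    (h2 : ∀ h y, L (leftTwo (Q.comul h) * y) = Q.counit h • L y)
    (h3 : ∀ h y, L (y * midTwo (Q.comul h)) = Q.counit h • L y) :
    L ((1 : H) ⊗ₜ[k] (Q.Phi : H ⊗[k] (H ⊗[k] H))) =
      L (Algebra.TensorProduct.map (AlgHom.id k H)
          (Algebra.TensorProduct.map (AlgHom.id k H)
            (Algebra.TensorProduct.includeLeft : H →ₐ[k] H ⊗[k] H))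
          ((Q.Phi⁻¹ : (H ⊗[k] (H ⊗[k] H))ˣ) : H ⊗[k] (H ⊗[k] H))) := by
  have hp : Algebra.TensorProduct.map (AlgHom.id k H)
          (Algebra.TensorProduct.map (AlgHom.id k H) Q.comul) (Q.Phi : H ⊗[k] (H ⊗[k] H)) *
        (Algebra.TensorProduct.assoc k k k H H (H ⊗[k] H)).toAlgHom.comp
          (Algebra.TensorProduct.map Q.comul (AlgHom.id k (H ⊗[k] H)))
            (Q.Phi : H ⊗[k] (H ⊗[k] H)) = _ := Q.pentagon
  generalize hAdef : Algebra.TensorProduct.map (AlgHom.id k H)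
          (Algebra.TensorProduct.map (AlgHom.id k H) Q.comul) = A at hp
  generalize hBdef : (Algebra.TensorProduct.assoc k k k H H (H ⊗[k] H)).toAlgHom.comp
          (Algebra.TensorProduct.map Q.comul (AlgHom.id k (H ⊗[k] H))) = B at hp
  generalize hCdef : Algebra.TensorProduct.map (AlgHom.id k H)
          ((Algebra.TensorProduct.assoc k k k H H H).toAlgHom.comp
            (Algebra.TensorProduct.map Q.comul (AlgHom.id k H))) = C at hp
  generalize Algebra.TensorProduct.map (AlgHom.id k H)
          (Algebra.TensorProduct.map (AlgHom.id k H)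
            (Algebra.TensorProduct.includeLeft : H →ₐ[k] H ⊗[k] H)) = D at hp ⊢
  have hA : ∀ (x : H ⊗[k] (H ⊗[k] H)) (y : H ⊗[k] (H ⊗[k] (H ⊗[k] H))), L (A x * y) =
      L (Algebra.TensorProduct.map (AlgHom.id k H)
        (Algebra.TensorProduct.includeLeft : H →ₐ[k] H ⊗[k] (H ⊗[k] H))
        (Algebra.TensorProduct.map (AlgHom.id k H) (Q.counitRight H) x) * y) := fun x y => by
    induction x using TensorProduct.induction_three with
    | zero => simp
    | add x y hx hy => simp only [map_add, add_mul, hx, hy]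
    | tmul a b c =>
      have : A (a ⊗ₜ[k] (b ⊗ₜ[k] c)) =
          rightTwo (Q.comul c) * (a ⊗ₜ[k] (b ⊗ₜ[k] (1 : H ⊗[k] H))) := by
        simp [← hAdef]
      rw [this, mul_assoc, h1]
      simp
  have hB : ∀ (x : H ⊗[k] (H ⊗[k] H)) (y : H ⊗[k] (H ⊗[k] (H ⊗[k] H))),
      L (B x * y) = L (rightTwo (Q.counitLeft (H ⊗[k] H) x) * y) := fun x y => by
    induction x using TensorProduct.induction_three with
    | zero => simp only [map_zero, zero_mul]
    | add x y hx hy => simp only [map_add, add_mul, hx, hy]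
    | tmul a b c =>
      rw [← hBdef, assoc_map_comul_tmul, mul_assoc, h2, counitLeft_tmul, map_smul,
        smul_mul_assoc, map_smul]
  have hC : ∀ (x : H ⊗[k] (H ⊗[k] H)) (y : H ⊗[k] (H ⊗[k] (H ⊗[k] H))), L (y * C x) =
      L (y * Algebra.TensorProduct.map (AlgHom.id k H)
        ((Algebra.TensorProduct.includeRight : H ⊗[k] H →ₐ[k] H ⊗[k] (H ⊗[k] H)).comp
          (Algebra.TensorProduct.includeRight : H →ₐ[k] H ⊗[k] H))
        (Algebra.TensorProduct.map (AlgHom.id k H) (Q.counitLeft H) x)) := fun x y => by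
    induction x using TensorProduct.induction_three with
    | zero => simp only [map_zero, mul_zero]
    | add x y hx hy => simp only [map_add, mul_add, hx, hy]
    | tmul a b c =>
      rw [← hCdef, map_assoc_map_comul_tmul, ← mul_assoc, h3]
      simp
  have hD1 : D Q.Phi * D ((Q.Phi⁻¹ : (H ⊗[k] (H ⊗[k] H))ˣ) : H ⊗[k] (H ⊗[k] H)) = 1 := by
    rw [← map_mul, Units.mul_inv, map_one]
  have hC1 : C Q.Phi * C ((Q.Phi⁻¹ : (H ⊗[k] (H ⊗[k] H))ˣ) : H ⊗[k] (H ⊗[k] H)) = 1 := by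
    rw [← map_mul, Units.mul_inv, map_one]
  -- The pentagon `A(Φ) B(Φ) = (1 ⊗ Φ) C(Φ) D(Φ)` is solved for `1 ⊗ Φ = A(Φ) B(Φ) D(Φ⁻¹) C(Φ⁻¹)`.
  -- Absorption replaces the coproduct in each of `A`, `B`, `C` by a counit, which turns these
  -- factors into `1`; only `D(Φ⁻¹)` survives.
  have hq := congrArg (fun z => z * D ((Q.Phi⁻¹ : (H ⊗[k] (H ⊗[k] H))ˣ) : H ⊗[k] (H ⊗[k] H)) *
    C ((Q.Phi⁻¹ : (H ⊗[k] (H ⊗[k] H))ˣ) : H ⊗[k] (H ⊗[k] H))) hp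
  simp only [mul_assoc] at hq
  rw [← mul_assoc (D _) (D _), hD1, one_mul, hC1, mul_one] at hq
  rw [← hq, hA, Q.counitRight_Phi, map_one, one_mul, hB, Q.counitLeft_Phi, map_one, one_mul, hC,
    Q.counit_Phi_inv, map_one, mul_one]

end QuasiBialgebra

/-! ### Contractions with the antipode, `α` and `β` -/

namespace QuasiHopfAlgebra

open QuasiBialgebra

variable {k : Type u} [Field k] {H : Type u} [Ring H] [Algebra k H]

/-- The map `a ⊗ b ⊗ z ↦ S(a) α b ⊗ z`. -/
def contractAlpha (Q : QuasiHopfAlgebra k H) (A : Type u) [Ring A] [Algebra k A] :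
    H ⊗[k] (H ⊗[k] A) →ₗ[k] H ⊗[k] A :=
  TensorProduct.map
    (LinearMap.mul' k H ∘ₗ TensorProduct.map
      (LinearMap.mulRight k Q.alpha ∘ₗ Q.antipode.toLinearMap) LinearMap.id)
    LinearMap.id ∘ₗ (TensorProduct.assoc k H H A).symm.toLinearMap

@[simp]
theorem contractAlpha_tmul (Q : QuasiHopfAlgebra k H) {A : Type u} [Ring A] [Algebra k A]
    (a b : H) (z : A) :
    Q.contractAlpha A (a ⊗ₜ (b ⊗ₜ z)) = (Q.antipode a * Q.alpha * b) ⊗ₜ z := by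
  simp [contractAlpha]

/-- The map `a ⊗ b ⊗ c ↦ b S⁻¹(a β) ⊗ c`. -/
def contractBeta (Q : QuasiHopfAlgebra k H) : H ⊗[k] (H ⊗[k] H) →ₗ[k] H ⊗[k] H :=
  TensorProduct.map
    (LinearMap.mul' k H ∘ₗ TensorProduct.map
        LinearMap.id (Q.antipode.symm.toLinearMap ∘ₗ LinearMap.mulRight k Q.beta) ∘ₗ
      (TensorProduct.comm k H H).toLinearMap)
    LinearMap.id ∘ₗ (TensorProduct.assoc k H H H).symm.toLinearMap

@[simp]
theorem contractBeta_tmul (Q : QuasiHopfAlgebra k H) (a b c : H) :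
    Q.contractBeta (a ⊗ₜ (b ⊗ₜ c)) = (b * Q.antipode.symm (a * Q.beta)) ⊗ₜ c := by
  simp [contractBeta]

theorem qL_eq (Q : QuasiHopfAlgebra k H) :
    Q.qL = Q.contractAlpha H ((Q.Phi⁻¹ : (H ⊗[k] (H ⊗[k] H))ˣ) : H ⊗[k] (H ⊗[k] H)) :=
  rfl

theorem pL_eq (Q : QuasiHopfAlgebra k H) :
    Q.pL = Q.contractBeta (Q.Phi : H ⊗[k] (H ⊗[k] H)) :=
  rfl

theorem antipode_symm_mul (Q : QuasiHopfAlgebra k H) (a b : H) :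
    Q.antipode.symm (a * b) = Q.antipode.symm b * Q.antipode.symm a := by
  apply Q.antipode.injective
  simp [Q.antipode_mul]

@[simp]
theorem antipode_symm_one (Q : QuasiHopfAlgebra k H) : Q.antipode.symm 1 = 1 := by
  rw [LinearEquiv.symm_apply_eq, Q.antipode_one]

/-- Left multiplication by `x ∈ H ⊗ H` in the first two factors, followed by `contractAlpha`. -/
theorem contractAlpha_assoc_mul (Q : QuasiHopfAlgebra k H) {A : Type u} [Ring A] [Algebra k A]
    (x : H ⊗[k] H) (c z : A) (a b : H) :
    Q.contractAlpha A (Algebra.TensorProduct.assoc k k k H H A (x ⊗ₜ c) * (a ⊗ₜ (b ⊗ₜ z))) =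
      (Q.antipode a * LinearMap.mul' k H (TensorProduct.map
      (LinearMap.mulRight k Q.alpha ∘ₗ Q.antipode.toLinearMap) LinearMap.id x) * b) ⊗ₜ (c * z) := by
  induction x with
  | zero => simp
  | add x y hx hy => simp only [map_add, TensorProduct.add_tmul, add_mul, mul_add, hx, hy]
  | tmul u v => simp [Q.antipode_mul, mul_assoc]

/-- The coproduct lands between `S(a)` and `b` as `∑ S(h₁) α h₂`, which the antipode axiom collapses
to `ε(h) α`. -/
theorem contractAlpha_assoc_comul_mul (Q : QuasiHopfAlgebra k H) {A : Type u} [Ring A]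
    [Algebra k A] (h : H) (c : A) (y : H ⊗[k] (H ⊗[k] A)) :
    Q.contractAlpha A (Algebra.TensorProduct.assoc k k k H H A (Q.comul h ⊗ₜ c) * y) =
      Q.counit h • (((1 : H) ⊗ₜ c) * Q.contractAlpha A y) := by
  induction y using TensorProduct.induction_three with
  | zero => simp
  | add x y hx hy => simp only [map_add, mul_add, smul_add, hx, hy]
  | tmul a b z =>
    rw [contractAlpha_assoc_mul, Q.antipode_comul]
    simp [TensorProduct.smul_tmul']

theorem contractAlpha_mul_tmul (Q : QuasiHopfAlgebra k H) {A : Type u} [Ring A] [Algebra k A]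
    (y : H ⊗[k] (H ⊗[k] A)) (a : H) (x : H ⊗[k] A) :
    Q.contractAlpha A (y * (a ⊗ₜ x)) =
      (Q.antipode a ⊗ₜ (1 : A)) * Q.contractAlpha A y * x := by
  induction y using TensorProduct.induction_three with
  | zero => simp
  | add x y hx hy => simp only [map_add, mul_add, add_mul, hx, hy]
  | tmul b c z =>
    induction x with
    | zero => simp
    | add x y hx hy => simp only [map_add, mul_add, TensorProduct.tmul_add, hx, hy]
    | tmul d w => simp [Q.antipode_mul, mul_assoc]

theorem contractAlpha_one_tmul (Q : QuasiHopfAlgebra k H) {A : Type u} [Ring A] [Algebra k A]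
    (x : H ⊗[k] A) :
    Q.contractAlpha A ((1 : H) ⊗ₜ x) = (Q.alpha ⊗ₜ (1 : A)) * x := by
  induction x with
  | zero => simp
  | add x y hx hy => simp only [map_add, mul_add, TensorProduct.tmul_add, hx, hy]
  | tmul d w => simp [Q.antipode_one]

theorem contractAlpha_includeLeft (Q : QuasiHopfAlgebra k H) (x : H ⊗[k] (H ⊗[k] H)) :
    Q.contractAlpha (H ⊗[k] H) (Algebra.TensorProduct.map (AlgHom.id k H)
          (Algebra.TensorProduct.map (AlgHom.id k H)
            (Algebra.TensorProduct.includeLeft : H →ₐ[k] H ⊗[k] H)) x) =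
      Algebra.TensorProduct.assoc k k k H H H (Q.contractAlpha H x ⊗ₜ (1 : H)) := by
  induction x using TensorProduct.induction_three with
  | zero => simp
  | add x y hx hy => simp only [map_add, TensorProduct.add_tmul, hx, hy]
  | tmul a b c => simp

theorem contractBeta_mul_assoc (Q : QuasiHopfAlgebra k H) (x : H ⊗[k] H) (a b c d : H) :
    Q.contractBeta ((a ⊗ₜ (b ⊗ₜ c)) * Algebra.TensorProduct.assoc k k k H H H (x ⊗ₜ d)) =
      (b * Q.antipode.symm (LinearMap.mul' k H (TensorProduct.map
        LinearMap.id (LinearMap.mulLeft k Q.beta ∘ₗ Q.antipode.toLinearMap) x)) *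
        Q.antipode.symm a) ⊗ₜ (c * d) := by
  induction x with
  | zero => simp
  | add x y hx hy => simp only [map_add, TensorProduct.add_tmul, add_mul, mul_add, hx, hy]
  | tmul u v => simp [antipode_symm_mul, mul_assoc]

/-- Since `v S⁻¹(u β) = S⁻¹(u β S(v))`, the coproduct appears as `S⁻¹(∑ h₁ β S(h₂))`, and the second
antipode axiom applies. -/
theorem contractBeta_mul_assoc_comul (Q : QuasiHopfAlgebra k H) (h d : H)
    (y : H ⊗[k] (H ⊗[k] H)) :
    Q.contractBeta (y * Algebra.TensorProduct.assoc k k k H H H (Q.comul h ⊗ₜ d)) =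
      Q.counit h • (Q.contractBeta y * ((1 : H) ⊗ₜ d)) := by
  induction y using TensorProduct.induction_three with
  | zero => simp
  | add x y hx hy => simp only [map_add, add_mul, smul_add, hx, hy]
  | tmul a b z =>
    rw [contractBeta_mul_assoc, Q.comul_antipode]
    simp [TensorProduct.smul_tmul', antipode_symm_mul, mul_assoc]

theorem contractBeta_tmul_mul (Q : QuasiHopfAlgebra k H) (a : H) (x : H ⊗[k] H)
    (y : H ⊗[k] (H ⊗[k] H)) :
    Q.contractBeta ((a ⊗ₜ x) * y) =
      x * Q.contractBeta y * (Q.antipode.symm a ⊗ₜ (1 : H)) := by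
  induction y using TensorProduct.induction_three with
  | zero => simp
  | add x y hx hy => simp only [map_add, mul_add, add_mul, hx, hy]
  | tmul b c z =>
    induction x with
    | zero => simp
    | add x y hx hy => simp only [map_add, add_mul, TensorProduct.tmul_add, hx, hy]
    | tmul d w => simp [antipode_symm_mul, mul_assoc]

/-- The two contractions together produce `S⁻¹` of `∑ S(X') α Y' β S(Z')`, and that sum is `1`. -/
theorem contractBeta_contractAlpha_Phi_inv (Q : QuasiHopfAlgebra k H) :
    Q.contractBeta (Algebra.TensorProduct.assoc k k k H H H (Q.contractAlpha H
      ((Q.Phi⁻¹ : (H ⊗[k] (H ⊗[k] H))ˣ) : H ⊗[k] (H ⊗[k] H)) ⊗ₜ (1 : H))) = 1 := by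
  have key : ∀ x : H ⊗[k] (H ⊗[k] H),
      Q.contractBeta (Algebra.TensorProduct.assoc k k k H H H (Q.contractAlpha H x ⊗ₜ (1 : H))) =
      Q.antipode.symm (LinearMap.mul' k H (TensorProduct.map
      Q.antipode.toLinearMap
      (LinearMap.mul' k H ∘ₗ TensorProduct.map
        (LinearMap.mulRight k Q.beta ∘ₗ LinearMap.mulLeft k Q.alpha)
        Q.antipode.toLinearMap) x)) ⊗ₜ (1 : H) := fun x => by
    induction x using TensorProduct.induction_three with
    | zero => simp
    | add x y hx hy => simp only [map_add, TensorProduct.add_tmul, hx, hy]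
    | tmul a b c => simp [antipode_symm_mul, mul_assoc]
  rw [key, Q.antipode_Phi_inv, antipode_symm_one, Algebra.TensorProduct.one_def]

end QuasiHopfAlgebra

/-! ### Linear algebra of `V ⊗ V`: contractions and traces -/

section Contraction

variable {k : Type u} [Field k] {V : Type u} [AddCommGroup V] [Module k V]

/-- Contract the left factor of `s : V ⊗ V` with a functional. -/
def contractFst (φ : V →ₗ[k] k) : V ⊗[k] V →ₗ[k] V :=
  (TensorProduct.lid k V).toLinearMap ∘ₗ TensorProduct.map φ LinearMap.id

@[simp]
theorem contractFst_tmul (φ : V →ₗ[k] k) (v w : V) : contractFst φ (v ⊗ₜ w) = φ v • w := by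
  simp [contractFst]

/-- Contract the right factor of `s : V ⊗ V` with a functional depending on a vector. -/
def contractSnd (G : V →ₗ[k] V →ₗ[k] k) (s : V ⊗[k] V) : V →ₗ[k] V :=
  (TensorProduct.rid k V).toLinearMap ∘ₗ (LinearMap.lTensorHom V).flip s ∘ₗ G

@[simp]
theorem contractSnd_zero (G : V →ₗ[k] V →ₗ[k] k) : contractSnd G 0 = 0 := by
  simp [contractSnd]

@[simp]
theorem contractSnd_add (G : V →ₗ[k] V →ₗ[k] k) (s t : V ⊗[k] V) :
    contractSnd G (s + t) = contractSnd G s + contractSnd G t := by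
  ext
  simp [contractSnd]

@[simp]
theorem contractSnd_tmul (G : V →ₗ[k] V →ₗ[k] k) (v w x : V) :
    contractSnd G (v ⊗ₜ w) x = G x w • v := by
  simp [contractSnd]

/-- For `s = ∑ a ⊗ b` both sides are `∑ φ(a) G(v, b)`. This lets properties of the map `V* → V`
given by `s` be tested on the endomorphism `contractSnd G s`. -/
theorem contract_comm (G : V →ₗ[k] V →ₗ[k] k) (s : V ⊗[k] V) (φ : V →ₗ[k] k) (v : V) :
    φ (contractSnd G s v) = G v (contractFst φ s) := by
  induction s with
  | zero => simp
  | add x y hx hy => simp [hx, hy]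
  | tmul a b => simp [mul_comm]

/-- The bilinear map `(v, u) ↦ g (u ⊗ v)`. -/
def flipForm (g : V ⊗[k] V →ₗ[k] k) : V →ₗ[k] V →ₗ[k] k :=
  (TensorProduct.mk k V V).flip.compr₂ g

@[simp]
theorem flipForm_apply (g : V ⊗[k] V →ₗ[k] k) (v u : V) : flipForm g v u = g (u ⊗ₜ v) :=
  rfl

variable [FiniteDimensional k V]

theorem trace_contractSnd (g : V ⊗[k] V →ₗ[k] k) (s : V ⊗[k] V) :
    LinearMap.trace k V (contractSnd (flipForm g) s) = g (TensorProduct.comm k V V s) := by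
  induction s with
  | zero => simp
  | add x y hx hy => simp [hx, hy]
  | tmul a b =>
    have : contractSnd (flipForm g) (a ⊗ₜ b) = (g ∘ₗ TensorProduct.mk k V V b).smulRight a := by
      ext
      simp
    simp [this]

/-- By bilinearity it suffices to take `f = φ ⊗ v` and `g = ψ ⊗ w` of rank one; both traces are then
`φ(w) ψ(v)`. -/
theorem trace_comm_comp_map (f g : V →ₗ[k] V) :
    LinearMap.trace k (V ⊗[k] V) ((TensorProduct.comm k V V).toLinearMap ∘ₗ TensorProduct.map f g) =
      LinearMap.trace k V (f ∘ₗ g) := by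
  obtain ⟨x, rfl⟩ := (dualTensorHomEquiv k V V).surjective f
  obtain ⟨y, rfl⟩ := (dualTensorHomEquiv k V V).surjective g
  induction x with
  | zero => simp
  | add x y hx hy =>
    simp only [map_add, TensorProduct.map_add_left, LinearMap.comp_add, LinearMap.add_comp, hx, hy]
  | tmul φ v =>
    induction y with
    | zero => simp
    | add x y hx hy =>
      simp only [map_add, TensorProduct.map_add_right, LinearMap.comp_add, hx, hy]
    | tmul ψ w =>
      have h1 : (TensorProduct.comm k V V).toLinearMap ∘ₗ
          TensorProduct.map (dualTensorHomEquiv k V V (φ ⊗ₜ v))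
            (dualTensorHomEquiv k V V (ψ ⊗ₜ w)) =
          ((TensorProduct.lid k k).toLinearMap ∘ₗ TensorProduct.map φ ψ).smulRight (w ⊗ₜ v) := by
        ext a b
        simp [TensorProduct.smul_tmul', smul_smul, TensorProduct.tmul_smul, mul_comm]
      have h2 : (dualTensorHomEquiv k V V (φ ⊗ₜ v)) ∘ₗ (dualTensorHomEquiv k V V (ψ ⊗ₜ w)) =
          (φ w • ψ).smulRight v := by
        ext a
        simp [smul_smul]
      rw [h1, h2]
      simp

/-- This moves the trace of `ν = m(q_L Δ(Λ) p_L)` to `V ⊗ V`, where `Δ(Λ)` acts as a projection. -/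
theorem trace_mul' {H : Type u} [Ring H] [Algebra k H] (r : H →ₐ[k] Module.End k V)
    (x : H ⊗[k] H) :
    LinearMap.trace k V (r (LinearMap.mul' k H x)) =
      LinearMap.trace k (V ⊗[k] V) ((TensorProduct.comm k V V).toLinearMap ∘ₗ boxAct r r x) := by
  induction x with
  | zero => simp
  | add x y hx hy => simp only [map_add, LinearMap.comp_add, hx, hy]
  | tmul a b => simp [trace_comm_comp_map, Module.End.mul_eq_comp]

end Contraction

/-! ### Invariant vectors, invariant forms and their zigzag -/

namespace QuasiHopfAlgebra

open QuasiBialgebra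

variable {k : Type u} [Field k] {H : Type u} [Ring H] [Algebra k H] {Q : QuasiHopfAlgebra k H}
variable {V : Type u} [AddCommGroup V] [Module k V] {r : H →ₐ[k] Module.End k V}
variable {t : V ⊗[k] V} {g : V ⊗[k] V →ₗ[k] k}

theorem contractFst_boxAct_tmul (φ : V →ₗ[k] k) (a b : H) (x : V ⊗[k] V) :
    contractFst φ (boxAct r r (a ⊗ₜ b) x) = r b (contractFst (φ ∘ₗ r a) x) := by
  induction x with
  | zero => simp
  | add x y hx hy => simp only [map_add, hx, hy]
  | tmul u v => simp

/-- An invariant vector of `V ⊗ V` yields an `H`-linear map from the left dual of `V` to `V`. -/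
theorem contractFst_qL_antipode (ht : ∀ h, boxAct r r (Q.comul h) t = Q.counit h • t)
    (φ : V →ₗ[k] k) (h : H) :
    contractFst (φ ∘ₗ r (Q.antipode h)) (boxAct r r Q.qL t) =
      r h (contractFst φ (boxAct r r Q.qL t)) := by
  have key : boxAct r r ((Q.antipode h ⊗ₜ (1 : H)) * Q.qL) t =
      boxAct r r (((1 : H) ⊗ₜ h) * Q.qL) t := by
    set Ψ := ((Q.Phi⁻¹ : (H ⊗[k] (H ⊗[k] H))ˣ) : H ⊗[k] (H ⊗[k] H)) with hΨ
    -- Both sides of quasi-coassociativity, rewritten for `Φ⁻¹`, are contracted with `α` and applied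
    -- to `t`: on the left the invariance of `t` removes a coproduct (`h1`), on the right the
    -- antipode axiom does (`h2`).
    have h0 : Ψ * Algebra.TensorProduct.map (AlgHom.id k H) Q.comul (Q.comul h) =
        Algebra.TensorProduct.assoc k k k H H H
          (Algebra.TensorProduct.map Q.comul (AlgHom.id k H) (Q.comul h)) * Ψ := by
      rw [hΨ, Units.inv_mul_eq_iff_eq_mul, ← mul_assoc, Q.Phi_comul, mul_assoc, Units.mul_inv,
        mul_one]
    have h1 : ∀ x : H ⊗[k] H, boxAct r r (Q.contractAlpha H
        (Ψ * Algebra.TensorProduct.map (AlgHom.id k H) Q.comul x)) t =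
        boxAct r r ((Q.antipode (Q.counitRight H x) ⊗ₜ (1 : H)) * Q.contractAlpha H Ψ) t :=
        fun x => by
      induction x with
      | zero => simp
      | add x y hx hy =>
        simp only [map_add, mul_add, LinearMap.add_apply, TensorProduct.add_tmul, add_mul, hx, hy]
      | tmul a b =>
        rw [Algebra.TensorProduct.map_tmul, contractAlpha_mul_tmul, map_mul, Module.End.mul_apply,
          ht, counitRight_tmul]
        simp [TensorProduct.map_smul_left]
    have h2 : ∀ x : H ⊗[k] H, Q.contractAlpha H (Algebra.TensorProduct.assoc k k k H H H
        (Algebra.TensorProduct.map Q.comul (AlgHom.id k H) x) * Ψ) =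
        ((1 : H) ⊗ₜ Q.counitLeft H x) * Q.contractAlpha H Ψ := fun x => by
      induction x with
      | zero => simp
      | add x y hx hy =>
        simp only [map_add, add_mul, TensorProduct.tmul_add, hx, hy]
      | tmul a b =>
        rw [Algebra.TensorProduct.map_tmul, contractAlpha_assoc_comul_mul, counitLeft_tmul]
        simp
    have h3 := h1 (Q.comul h)
    rw [h0, h2, counitLeft_comul, counitRight_comul] at h3
    exact h3.symm
  have := congrArg (contractFst φ) key
  rw [map_mul, map_mul, Module.End.mul_apply, Module.End.mul_apply, contractFst_boxAct_tmul,
    contractFst_boxAct_tmul] at this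
  simpa using! this

/-- An invariant form on `V ⊗ V` yields an `H`-linear map from `V` to the right dual of `V`. -/
theorem flipForm_pL_antipode (hg : ∀ h x, g (boxAct r r (Q.comul h) x) = Q.counit h • g x)
    (h : H) (v u : V) :
    flipForm (g ∘ₗ boxAct r r Q.pL) (r h v) u =
      flipForm (g ∘ₗ boxAct r r Q.pL) v (r (Q.antipode.symm h) u) := by
  -- Quasi-coassociativity is contracted with `β`: invariance of `g` handles one side (`h1`), the
  -- axiom `∑ h₁ β S(h₂) = ε(h) β` the other (`h2`).
  have h1 : ∀ x : H ⊗[k] H, ∀ w, g (boxAct r r (Q.contractBeta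
      (Algebra.TensorProduct.map (AlgHom.id k H) Q.comul x * Q.Phi)) w) =
      g (boxAct r r (Q.pL * (Q.antipode.symm (Q.counitRight H x) ⊗ₜ (1 : H))) w) := fun x w => by
    induction x with
    | zero => simp
    | add x y hx hy =>
      simp only [map_add, mul_add, LinearMap.add_apply, TensorProduct.add_tmul, add_mul, hx, hy]
    | tmul a b =>
      rw [Algebra.TensorProduct.map_tmul, contractBeta_tmul_mul, mul_assoc, map_mul,
        Module.End.mul_apply, hg, counitRight_tmul, ← pL_eq]
      simp [← TensorProduct.smul_tmul']
  have h2 : ∀ x : H ⊗[k] H, Q.contractBeta (Q.Phi * Algebra.TensorProduct.assoc k k k H H H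
      (Algebra.TensorProduct.map Q.comul (AlgHom.id k H) x)) =
      Q.pL * ((1 : H) ⊗ₜ Q.counitLeft H x) := fun x => by
    induction x with
    | zero => simp
    | add x y hx hy =>
      simp only [map_add, mul_add, TensorProduct.tmul_add, hx, hy]
    | tmul a b =>
      rw [Algebra.TensorProduct.map_tmul, contractBeta_mul_assoc_comul, counitLeft_tmul, ← pL_eq]
      simp
  have h3 := h1 (Q.comul h) (u ⊗ₜ v)
  rw [← Q.Phi_comul, h2, counitLeft_comul, counitRight_comul] at h3
  simpa using h3

/-- The zigzag `v ↦ (id ⊗ g)(Φ (t ⊗ v))`. -/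
def snake (Q : QuasiHopfAlgebra k H) (r : H →ₐ[k] Module.End k V) (t : V ⊗[k] V)
    (g : V ⊗[k] V →ₗ[k] k) (v : V) : V :=
  TensorProduct.rid k V (TensorProduct.map LinearMap.id g
    (boxAct r (boxAct r r) (Q.Phi : H ⊗[k] (H ⊗[k] H)) (TensorProduct.assoc k V V V (t ⊗ₜ v))))

theorem contractAlpha_rightTwo_mul (Q : QuasiHopfAlgebra k H) (x : H ⊗[k] H)
    (y : H ⊗[k] (H ⊗[k] (H ⊗[k] H))) :
    Q.contractAlpha (H ⊗[k] H) (rightTwo x * y) =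
      ((1 : H) ⊗ₜ x) * Q.contractAlpha (H ⊗[k] H) y := by
  induction y using TensorProduct.induction_three with
  | zero => simp
  | add x y hx hy => simp only [map_add, mul_add, hx, hy]
  | tmul a b z => simp

theorem contractAlpha_leftTwo_mul (Q : QuasiHopfAlgebra k H) (h : H)
    (y : H ⊗[k] (H ⊗[k] (H ⊗[k] H))) :
    Q.contractAlpha (H ⊗[k] H) (leftTwo (Q.comul h) * y) =
      Q.counit h • Q.contractAlpha (H ⊗[k] H) y := by
  have := Q.contractAlpha_assoc_comul_mul h (1 : H ⊗[k] H) y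
  rw [← Algebra.TensorProduct.one_def, one_mul] at this
  exact this

theorem contractAlpha_mul_midTwo (Q : QuasiHopfAlgebra k H) (x : H ⊗[k] H)
    (y : H ⊗[k] (H ⊗[k] (H ⊗[k] H))) :
    Q.contractAlpha (H ⊗[k] H) (y * midTwo x) =
      Q.contractAlpha (H ⊗[k] H) y * Algebra.TensorProduct.assoc k k k H H H (x ⊗ₜ (1 : H)) := by
  have := Q.contractAlpha_mul_tmul y 1 (Algebra.TensorProduct.assoc k k k H H H (x ⊗ₜ (1 : H)))
  rw [Q.antipode_one, ← Algebra.TensorProduct.one_def, one_mul] at this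
  exact this

theorem boxAct_assoc_tmul_one (x : H ⊗[k] H) (v : V) :
    boxAct r (boxAct r r) (Algebra.TensorProduct.assoc k k k H H H (x ⊗ₜ (1 : H)))
      (TensorProduct.assoc k V V V (t ⊗ₜ v)) =
    TensorProduct.assoc k V V V (boxAct r r x t ⊗ₜ v) := by
  rw [← boxAct_assoc]
  simp

/-- The map `y ↦ (φ ⊗ g)(contractAlpha(y) · (t ⊗ v))` absorbs coproducts: in the last two slots by
invariance of `g`, in the first two by the antipode axiom, in the middle by invariance of `t`. Its
value at `1 ⊗ Φ` is the left side, its value at `Φ⁻¹ ⊗ 1` the right side. -/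
theorem snake_alpha (ht : ∀ h, boxAct r r (Q.comul h) t = Q.counit h • t)
    (hg : ∀ h x, g (boxAct r r (Q.comul h) x) = Q.counit h • g x) (φ : V →ₗ[k] k) (v : V) :
    φ (r Q.alpha (Q.snake r t g v)) = g (contractFst φ (boxAct r r Q.qL t) ⊗ₜ v) := by
  let ψ : V ⊗[k] (V ⊗[k] V) →ₗ[k] k :=
    (TensorProduct.lid k k).toLinearMap ∘ₗ TensorProduct.map φ g
  let w : V ⊗[k] (V ⊗[k] V) := TensorProduct.assoc k V V V (t ⊗ₜ v)
  let L : H ⊗[k] (H ⊗[k] (H ⊗[k] H)) →ₗ[k] k :=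
    ψ ∘ₗ LinearMap.applyₗ w ∘ₗ (boxAct r (boxAct r r)).toLinearMap ∘ₗ Q.contractAlpha (H ⊗[k] H)
  have hL : ∀ y, L y = ψ (boxAct r (boxAct r r) (Q.contractAlpha (H ⊗[k] H) y) w) := fun _ => rfl
  have hψ : ∀ h x, ψ (boxAct r (boxAct r r) ((1 : H) ⊗ₜ Q.comul h) x) = Q.counit h • ψ x := by
    intro h x
    induction x with
    | zero => simp
    | add x y hx hy => simp only [map_add, smul_add, hx, hy]
    | tmul a b => simp [ψ, hg, mul_left_comm]
  have key := Q.eq_of_absorbs_comul L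
    (fun h y => by
      rw [hL, hL, contractAlpha_rightTwo_mul, map_mul, Module.End.mul_apply, hψ])
    (fun h y => by
      rw [hL, hL, contractAlpha_leftTwo_mul]; simp)
    (fun h y => by
      rw [hL, hL, contractAlpha_mul_midTwo, map_mul, Module.End.mul_apply, boxAct_assoc_tmul_one,
        ht, ← TensorProduct.smul_tmul']
      simp [w])
  rw [hL, hL, contractAlpha_one_tmul, contractAlpha_includeLeft, boxAct_assoc_tmul_one, ← qL_eq,
    map_mul, Module.End.mul_apply] at key
  have e1 : ∀ z : V ⊗[k] (V ⊗[k] V), ψ (boxAct r (boxAct r r) (Q.alpha ⊗ₜ (1 : H ⊗[k] H)) z) =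
      φ (r Q.alpha (TensorProduct.rid k V (TensorProduct.map LinearMap.id g z))) := fun z => by
    induction z with
    | zero => simp
    | add x y hx hy => simp only [map_add, hx, hy]
    | tmul a b => simp [ψ, mul_comm]
  have e2 : ∀ z : V ⊗[k] V, ψ (TensorProduct.assoc k V V V (z ⊗ₜ v)) =
      g (contractFst φ z ⊗ₜ v) := fun z => by
    induction z with
    | zero => simp
    | add x y hx hy => simp only [map_add, TensorProduct.add_tmul, hx, hy]
    | tmul a b => simp [ψ, ← TensorProduct.smul_tmul']
  rw [e1, e2] at key
  exact key

/-- Here the absorbing map contracts with `α` and then with `β`. At `1 ⊗ Φ` it yields `p_L (S⁻¹(α) ⊗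
1)`, at `Φ⁻¹ ⊗ 1` it yields `1`. In particular `g` can be recovered from the map `V → V*` built with
`p_L`. -/
theorem form_eq_flipForm_pL (hg : ∀ h x, g (boxAct r r (Q.comul h) x) = Q.counit h • g x)
    (u v : V) :
    g (u ⊗ₜ v) = flipForm (g ∘ₗ boxAct r r Q.pL) v (r (Q.antipode.symm Q.alpha) u) := by
  let L : H ⊗[k] (H ⊗[k] (H ⊗[k] H)) →ₗ[k] k :=
    g ∘ₗ LinearMap.applyₗ (u ⊗ₜ[k] v) ∘ₗ (boxAct r r).toLinearMap ∘ₗ Q.contractBeta ∘ₗ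
      Q.contractAlpha (H ⊗[k] H)
  have hL : ∀ y, L y = g (boxAct r r (Q.contractBeta (Q.contractAlpha (H ⊗[k] H) y)) (u ⊗ₜ v)) :=
    fun _ => rfl
  have key := Q.eq_of_absorbs_comul L
    (fun h y => by
      rw [hL, hL, contractAlpha_rightTwo_mul, contractBeta_tmul_mul, antipode_symm_one,
        ← Algebra.TensorProduct.one_def, mul_one, map_mul, Module.End.mul_apply, hg])
    (fun h y => by
      rw [hL, hL, contractAlpha_leftTwo_mul]; simp)
    (fun h y => by
      rw [hL, hL, contractAlpha_mul_midTwo, contractBeta_mul_assoc_comul,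
        ← Algebra.TensorProduct.one_def, mul_one]
      simp)
  rw [hL, hL, contractAlpha_one_tmul, contractBeta_tmul_mul, one_mul, contractAlpha_includeLeft,
    contractBeta_contractAlpha_Phi_inv, map_one, Module.End.one_apply, ← pL_eq, map_mul,
    Module.End.mul_apply] at key
  rw [← key]
  simp

end QuasiHopfAlgebra

/-! ### The trace of `ν` on an absolutely irreducible representation -/

/-- A nonzero representation without proper nonzero subrepresentations all of whose endomorphisms
are scalars. -/
structure IsAbsolutelyIrreducible {k : Type u} [Field k] {H : Type u} [Ring H] [Algebra k H]
    {V : Type u} [AddCommGroup V] [Module k V] (r : H →ₐ[k] Module.End k V) : Prop where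
  nontrivial : Nontrivial V
  eq_bot_or_eq_top (W : Submodule k V) (hW : ∀ h, ∀ w ∈ W, r h w ∈ W) : W = ⊥ ∨ W = ⊤
  exists_eq_smul (f : V →ₗ[k] V) (hf : ∀ h v, f (r h v) = r h (f v)) :
    ∃ c : k, f = c • LinearMap.id

namespace QuasiHopfAlgebra

open QuasiBialgebra

variable {k : Type u} [Field k] {H : Type u} [Ring H] [Algebra k H] {Q : QuasiHopfAlgebra k H}
variable {V : Type u} [AddCommGroup V] [Module k V] {r : H →ₐ[k] Module.End k V}
variable {t : V ⊗[k] V} {g : V ⊗[k] V →ₗ[k] k}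

/-- Every term of `∑ X β S(Y) α Z = 1` contains `α`, so if `α` acted by zero, so would `1`. -/
theorem act_alpha_ne_zero [Nontrivial V] : r Q.alpha ≠ 0 := by
  intro h0
  have key : ∀ x : H ⊗[k] (H ⊗[k] H), r (LinearMap.mul' k H (TensorProduct.map
      LinearMap.id
      (LinearMap.mul' k H ∘ₗ TensorProduct.map
        (LinearMap.mulRight k Q.alpha ∘ₗ LinearMap.mulLeft k Q.beta ∘ₗ Q.antipode.toLinearMap)
        LinearMap.id) x)) = 0 := fun x => by
    induction x using TensorProduct.induction_three with
    | zero => simp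
    | add x y hx hy => simp only [map_add, hx, hy, add_zero]
    | tmul a b c => simp [h0]
  have h1 := key Q.Phi
  rw [Q.antipode_Phi, map_one] at h1
  exact one_ne_zero h1

/-- Schur's lemma for the maps `G, G' : V → V*` attached to `g, g'`. The kernel of `G` is stable and
proper, so `G` is an isomorphism by dimension; `G⁻¹ G'` commutes with `H` and is a scalar, and the
forms are recovered from `G` and `G'`. -/
theorem form_eq_smul [FiniteDimensional k V] (hr : IsAbsolutelyIrreducible r)
    {g' : V ⊗[k] V →ₗ[k] k}
    (hg : ∀ h x, g (boxAct r r (Q.comul h) x) = Q.counit h • g x)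
    (hg' : ∀ h x, g' (boxAct r r (Q.comul h) x) = Q.counit h • g' x) (hne : g ≠ 0) :
    ∃ c : k, g' = c • g := by
  set G := flipForm (g ∘ₗ boxAct r r Q.pL) with hG
  set G' := flipForm (g' ∘ₗ boxAct r r Q.pL) with hG'
  have hker : LinearMap.ker G = ⊥ := by
    refine (hr.eq_bot_or_eq_top (LinearMap.ker G) (fun h w hw => ?_)).resolve_right (fun htop => ?_)
    · rw [LinearMap.mem_ker] at hw ⊢
      ext u
      rw [hG, flipForm_pL_antipode hg, ← hG, hw]
      rfl
    · apply hne
      ext u v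
      have : G = 0 := LinearMap.ker_eq_top.mp htop
      have h2 := form_eq_flipForm_pL hg u v
      rw [← hG, this] at h2
      simpa using h2
  have hinj : Function.Injective G := LinearMap.ker_eq_bot.mp hker
  let e : V ≃ₗ[k] Module.Dual k V :=
    LinearEquiv.ofInjectiveOfFinrankEq G hinj Subspace.dual_finrank_eq.symm
  have he : ∀ v, e v = G v := fun v => rfl
  obtain ⟨c, hc⟩ := hr.exists_eq_smul (e.symm.toLinearMap ∘ₗ G') (fun h v => by
    apply hinj
    have h1 : ∀ w, G (e.symm w) = w := fun w => e.apply_symm_apply w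
    ext u
    rw [hG, flipForm_pL_antipode hg, ← hG]
    simp only [LinearMap.comp_apply, LinearEquiv.coe_coe, h1]
    exact flipForm_pL_antipode hg' h v u)
  refine ⟨c, ?_⟩
  ext u v
  have h3 : G' v = c • G v := by
    have := congrArg e (LinearMap.congr_fun hc v)
    rw [LinearMap.comp_apply, LinearEquiv.coe_coe, e.apply_symm_apply] at this
    simpa [he] using this
  have h2 := form_eq_flipForm_pL hg u v
  have h2' := form_eq_flipForm_pL hg' u v
  rw [← hG] at h2
  rw [← hG', h3] at h2'
  simp only [TensorProduct.AlgebraTensorModule.curry_apply, LinearMap.restrictScalars_self,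
    TensorProduct.curry_apply, LinearMap.smul_apply]
  rw [h2, h2', LinearMap.smul_apply]

section Integral

variable [IsSemisimpleRing H]

theorem comul_integral_invariant (h : H) (x : V ⊗[k] V) :
    boxAct r r (Q.comul h) (boxAct r r (Q.comul Q.integral) x) =
      Q.counit h • boxAct r r (Q.comul Q.integral) x := by
  rw [← Module.End.mul_apply, ← map_mul, ← map_mul, Q.isNormalizedIntegral_integral.left]
  simp

theorem form_comul_integral (f : V ⊗[k] V →ₗ[k] k) (h : H) (x : V ⊗[k] V) :
    (f ∘ₗ boxAct r r (Q.comul Q.integral)) (boxAct r r (Q.comul h) x) =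
      Q.counit h • (f ∘ₗ boxAct r r (Q.comul Q.integral)) x := by
  rw [LinearMap.comp_apply, ← Module.End.mul_apply, ← map_mul, ← map_mul,
    Q.isNormalizedIntegral_integral.right]
  simp

theorem comul_integral_of_invariant (ht : ∀ h, boxAct r r (Q.comul h) t = Q.counit h • t) :
    boxAct r r (Q.comul Q.integral) t = t := by
  rw [ht, Q.isNormalizedIntegral_integral.counit_eq_one, one_smul]

/-- A functional that is nonzero at `t` is averaged by `Δ(Λ)`; as `Δ(Λ)` fixes `t`, its value there
is unchanged and can be normalized. -/
theorem exists_form_eq_one (ht : ∀ h, boxAct r r (Q.comul h) t = Q.counit h • t) (hne : t ≠ 0) :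
    ∃ g : V ⊗[k] V →ₗ[k] k,
      (∀ h x, g (boxAct r r (Q.comul h) x) = Q.counit h • g x) ∧ g t = 1 := by
  obtain ⟨f, hf⟩ := Module.Projective.exists_dual_ne_zero k hne
  refine ⟨(f t)⁻¹ • (f ∘ₗ boxAct r r (Q.comul Q.integral)), fun h x => ?_, ?_⟩
  · rw [LinearMap.smul_apply, form_comul_integral, LinearMap.smul_apply, smul_comm]
  · rw [LinearMap.smul_apply, LinearMap.comp_apply, comul_integral_of_invariant ht]
    simp [hf]

theorem trace_nu_eq_zero [FiniteDimensional k V]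
    (h0 : ∀ t : V ⊗[k] V, (∀ h, boxAct r r (Q.comul h) t = Q.counit h • t) → t = 0) :
    LinearMap.trace k V (r Q.nu) = 0 := by
  have h1 : boxAct r r (Q.comul Q.integral) = 0 := by
    apply LinearMap.ext
    intro x
    exact h0 _ (fun h => comul_integral_invariant h x)
  rw [nu, trace_mul', map_mul, map_mul, h1]
  simp

/-- Otherwise some invariant form is `1` at `s - g(s) t`; but every invariant form is a multiple of
`g`, which vanishes there. -/
theorem invariant_eq_smul [FiniteDimensional k V] (hr : IsAbsolutelyIrreducible r)
    (ht : ∀ h, boxAct r r (Q.comul h) t = Q.counit h • t)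
    (hg : ∀ h x, g (boxAct r r (Q.comul h) x) = Q.counit h • g x) (hgt : g t = 1)
    {s : V ⊗[k] V} (hs : ∀ h, boxAct r r (Q.comul h) s = Q.counit h • s) : s = g s • t := by
  by_contra hne
  obtain ⟨g', hg', h1⟩ := exists_form_eq_one (Q := Q) (r := r) (t := s - g s • t)
    (fun h => by rw [map_sub, map_smul, hs, ht, smul_sub, smul_comm]) (sub_ne_zero.mpr hne)
  obtain ⟨c, rfl⟩ := form_eq_smul hr hg hg' (by rintro rfl; simp at hgt)
  simp [hgt] at h1

/-- For an absolutely irreducible `V` with invariants `t ∈ V ⊗ V` and `g : V ⊗ V → k`,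
`g(t) = 1`, the indicator of `V` is `dim V` times the scalar by which the zigzag of `t` and `g`
acts. -/
theorem trace_nu_eq [FiniteDimensional k V] (hr : IsAbsolutelyIrreducible r)
    (ht : ∀ h, boxAct r r (Q.comul h) t = Q.counit h • t)
    (hg : ∀ h x, g (boxAct r r (Q.comul h) x) = Q.counit h • g x) (hgt : g t = 1) {μ : k}
    (hμ : ∀ v, Q.snake r t g v = μ • v) :
    LinearMap.trace k V (r Q.nu) = μ * Module.finrank k V := by
  set G := flipForm (g ∘ₗ boxAct r r Q.pL) with hG
  set s := boxAct r r Q.qL t with hs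
  -- The composite `V → V* → V` commutes with `H`: moving `h` through `G` produces `S⁻¹(h)`, and
  -- moving that through `s` restores `h`.
  obtain ⟨c, hc⟩ := hr.exists_eq_smul (contractSnd G s) (fun h v => by
    rw [← sub_eq_zero, ← Module.forall_dual_apply_eq_zero_iff k]
    intro φ
    have h1 := contractFst_qL_antipode ht φ (Q.antipode.symm h)
    rw [LinearEquiv.apply_symm_apply] at h1
    rw [map_sub, sub_eq_zero, contract_comm, hG, flipForm_pL_antipode hg, ← hG, hs, ← h1,
      ← contract_comm, LinearMap.comp_apply])
  -- `Δ(Λ)` is the projection onto the line of invariants.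
  have hP : boxAct r r (Q.comul Q.integral) = g.smulRight t := by
    apply LinearMap.ext
    intro x
    rw [LinearMap.smulRight_apply,
      invariant_eq_smul hr ht hg hgt (fun h => comul_integral_invariant h x), hg,
      Q.isNormalizedIntegral_integral.counit_eq_one, one_smul]
  have htr : LinearMap.trace k V (r Q.nu) = c * Module.finrank k V := by
    have h1 : (TensorProduct.comm k V V).toLinearMap ∘ₗ
        boxAct r r (Q.qL * Q.comul Q.integral * Q.pL) =
        (g ∘ₗ boxAct r r Q.pL).smulRight (TensorProduct.comm k V V s) := by
      rw [map_mul, map_mul, hP]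
      apply LinearMap.ext
      intro x
      simp [hs]
    rw [nu, trace_mul', h1, LinearMap.trace_smulRight, ← trace_contractSnd, ← hG, hc]
    simp
  have hcμ : c = μ := by
    have := hr.nontrivial
    obtain ⟨v, hv⟩ : ∃ v, r Q.alpha v ≠ 0 := by
      by_contra! h
      exact act_alpha_ne_zero (Q := Q) (r := r) (LinearMap.ext h)
    obtain ⟨φ, hφ⟩ := Module.Projective.exists_dual_ne_zero k hv
    have h1 := snake_alpha ht hg φ v
    -- The factor `S⁻¹(α)` is moved across `G` to become `α` acting on `v`, which leaves `μ φ(α v) =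
    -- c φ(α v)`.
    rw [hμ, form_eq_flipForm_pL hg, ← hG, ← hs, hG, ← flipForm_pL_antipode hg, ← hG,
      ← contract_comm, hc] at h1
    simpa [hφ] using h1.symm
  rw [htr, hcμ]

end Integral

end QuasiHopfAlgebra

open MonoidalCategory in
/-- The zigzag of `t : 𝟙 ⟶ V ⊗ V` and `g : V ⊗ V ⟶ 𝟙`. -/
def CategoryTheory.MonoidalCategory.zigzag {C : Type*} [Category C] [MonoidalCategory C]
    {V : C} (t : 𝟙_ C ⟶ V ⊗ V) (g : V ⊗ V ⟶ 𝟙_ C) : V ⟶ V :=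
  (λ_ V).inv ≫ (t ▷ V) ≫ (α_ V V V).hom ≫ (V ◁ g) ≫ (ρ_ V).hom

/-! ### Modules with scalar endomorphisms, finiteness and tensor powers -/

namespace QuasiBialgebra.LMod

open MonoidalCategory

variable {k : Type u} [Field k] {H : Type u} [Ring H] [Algebra k H] {Q : QuasiBialgebra k H}

/-- The `H`-module structure underlying an object of `LMod Q`. -/
abbrev moduleH (M : LMod Q) : Module H M.carrier :=
  Module.compHom M.carrier M.act.toRingHom

theorem isScalarTower_moduleH (M : LMod Q) :
    letI := M.moduleH
    IsScalarTower k H M.carrier := by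
  let := M.moduleH
  refine ⟨fun c h m => ?_⟩
  change M.act (c • h) m = c • M.act h m
  simp

/-- The character of a module. -/
def char (M : LMod Q) : H →ₗ[k] k :=
  LinearMap.trace k M.carrier ∘ₗ M.act.toLinearMap

theorem char_apply (M : LMod Q) (h : H) : M.char h = LinearMap.trace k M.carrier (M.act h) :=
  rfl

/-- The linear isomorphism underlying an isomorphism of modules. -/
def toLinearEquiv {M N : LMod Q} (e : M ≅ N) : M.carrier ≃ₗ[k] N.carrier :=
  LinearEquiv.ofLinearMap e.hom.toLin e.inv.toLin
    (by rw [← comp_toLin, e.inv_hom_id]; rfl) (by rw [← comp_toLin, e.hom_inv_id]; rfl)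

theorem char_eq_of_iso {M N : LMod Q} (e : M ≅ N) : M.char = N.char := by
  ext h
  have : N.act h = (toLinearEquiv e).conj (M.act h) := by
    ext n
    rw [LinearEquiv.conj_apply_apply]
    change _ = e.hom.toLin _
    rw [e.hom.map_act]
    congr 1
    exact ((toLinearEquiv e).apply_symm_apply n).symm
  rw [char_apply, char_apply, this, LinearMap.trace_conj']

/-- A nonzero module whose endomorphisms are scalars. -/
def IsBrick (M : LMod Q) : Prop :=
  𝟙 M ≠ 0 ∧ ∀ f : M ⟶ M, ∃ c : k, f = c • 𝟙 M

/-- The linear map from `H`-linear maps to linear maps. -/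
def toLinLinear (M N : LMod Q) : (M ⟶ N) →ₗ[k] (M.carrier →ₗ[k] N.carrier) where
  toFun f := f.toLin
  map_add' _ _ := rfl
  map_smul' _ _ := rfl

theorem toLinLinear_injective (M N : LMod Q) : Function.Injective (toLinLinear M N) :=
  toLin_injective M N

instance (M N : LMod Q) [FiniteDimensional k M.carrier] [FiniteDimensional k N.carrier] :
    FiniteDimensional k (M ⟶ N) :=
  Module.Finite.of_injective _ (toLinLinear_injective M N)

theorem finrank_hom_le (M N : LMod Q) [FiniteDimensional k M.carrier]
    [FiniteDimensional k N.carrier] :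
    Module.finrank k (M ⟶ N) ≤ Module.finrank k M.carrier * Module.finrank k N.carrier := by
  rw [← Module.finrank_linearMap]
  exact LinearMap.finrank_le_finrank_of_injective (toLinLinear_injective M N)

/-- An `H`-stable subspace of a module over a semisimple ring is the image of an idempotent
endomorphism. -/
theorem exists_projection [IsSemisimpleRing H] (M : LMod Q) (W : Submodule k M.carrier)
    (hW : ∀ h, ∀ w ∈ W, M.act h w ∈ W) :
    ∃ f : M ⟶ M, (∀ m, f.toLin m ∈ W) ∧ ∀ w ∈ W, f.toLin w = w := by
  let := M.moduleH
  have := M.isScalarTower_moduleH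
  let W' : Submodule H M.carrier := { W with smul_mem' := hW }
  obtain ⟨C, hC⟩ := exists_isCompl W'
  let p := Submodule.projection W' C hC
  exact ⟨⟨p.restrictScalars k, fun h m => p.map_smul h m⟩,
    fun m => Submodule.projection_apply_mem hC m,
    fun w hw => Submodule.projection_apply_left hC ⟨w, hw⟩⟩

theorem IsBrick.nontrivial {M : LMod Q} (hM : M.IsBrick) : Nontrivial M.carrier := by
  by_contra h
  rw [not_nontrivial_iff_subsingleton] at h
  exact hM.1 (hom_ext (LinearMap.ext fun m => Subsingleton.elim _ _))

/-- By semisimplicity a stable subspace is the image of an idempotent endomorphism, which is a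
scalar `c` here; `c = 0` gives the zero subspace, `c ≠ 0` the whole module. -/
theorem IsBrick.isAbsolutelyIrreducible [IsSemisimpleRing H] {M : LMod Q} (hM : M.IsBrick) :
    IsAbsolutelyIrreducible M.act where
  nontrivial := hM.nontrivial
  eq_bot_or_eq_top W hW := by
    obtain ⟨f, hf, hfW⟩ := M.exists_projection W hW
    obtain ⟨c, rfl⟩ := hM.2 f
    by_cases hc : c = 0
    · left
      rw [eq_bot_iff]
      intro w hw
      have := hfW w hw
      subst hc
      simpa using! this.symm
    · right
      rw [eq_top_iff]
      intro m _
      have := W.smul_mem c⁻¹ (hf m)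
      simpa [smul_smul, hc] using this
  exists_eq_smul f hf := by
    obtain ⟨c, hc⟩ := hM.2 ⟨f, fun h m => hf h m⟩
    exact ⟨c, congrArg Hom.toLin hc⟩

/-- Any nonzero vector generates, so the module is a quotient of `H`. -/
theorem IsBrick.finiteDimensional [IsSemisimpleRing H] [FiniteDimensional k H] {M : LMod Q}
    (hM : M.IsBrick) : FiniteDimensional k M.carrier := by
  have := hM.nontrivial
  obtain ⟨v, hv⟩ := exists_ne (0 : M.carrier)
  let f : H →ₗ[k] M.carrier := LinearMap.applyₗ v ∘ₗ M.act.toLinearMap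
  have hf : ∀ h, f h = M.act h v := fun _ => rfl
  have hr := (hM.isAbsolutelyIrreducible.eq_bot_or_eq_top (LinearMap.range f) (by
    rintro h _ ⟨x, rfl⟩
    exact ⟨h * x, by simp [hf]⟩)).resolve_left (fun hbot => hv (by
      have : f 1 ∈ LinearMap.range f := ⟨1, rfl⟩
      rw [hbot, Submodule.mem_bot] at this
      simpa [hf] using this))
  exact Module.Finite.of_surjective f (LinearMap.range_eq_top.mp hr)

/-- This makes finite-dimensionality a property that a linear equivalence can see. Sending a
submodule `W` to the endomorphisms with image in `W` is strictly monotone, because projections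
exist; so submodules satisfy the ascending chain condition and `M` is finitely generated over `H`.
-/
theorem finiteDimensional_of_end [IsSemisimpleRing H] [FiniteDimensional k H] (M : LMod Q)
    [FiniteDimensional k (M ⟶ M)] : FiniteDimensional k M.carrier := by
  let := M.moduleH
  have := M.isScalarTower_moduleH
  let Φ : Submodule H M.carrier → Submodule k (M ⟶ M) := fun W =>
    { carrier := {f | ∀ m, f.toLin m ∈ W}
      add_mem' := fun hf hg m => W.add_mem (hf m) (hg m)
      zero_mem' := fun m => W.zero_mem
      smul_mem' := fun c f hf m => W.smul_of_tower_mem c (hf m) }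
  have hΦ : StrictMono Φ := by
    intro W W' hlt
    refine lt_of_le_not_ge (fun f hf m => hlt.le (hf m)) (fun hle => hlt.not_ge ?_)
    obtain ⟨f, hf, hfW⟩ := M.exists_projection (W'.restrictScalars k)
      (fun h w hw => W'.smul_mem h hw)
    intro w hw
    have := hle (show f ∈ Φ W' from hf) w
    rwa [hfW w hw] at this
  have : WellFoundedGT (Submodule H M.carrier) := hΦ.wellFoundedGT
  have : IsNoetherian H M.carrier := isNoetherian_iff'.mpr this
  exact Module.Finite.trans H M.carrier

/-- The regular module. -/
def regular (Q : QuasiBialgebra k H) : LMod Q where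
  carrier := H
  act := Algebra.lmul k H

instance [FiniteDimensional k H] : FiniteDimensional k (regular Q).carrier :=
  inferInstanceAs (FiniteDimensional k H)

/-- Evaluation at `1`. -/
def evalOne (M : LMod Q) : (regular Q ⟶ M) →ₗ[k] M.carrier :=
  LinearMap.applyₗ (1 : H) ∘ₗ toLinLinear (regular Q) M

theorem evalOne_surjective (M : LMod Q) : Function.Surjective M.evalOne := by
  intro m
  refine ⟨⟨LinearMap.applyₗ m ∘ₗ M.act.toLinearMap, fun h (x : H) => ?_⟩, ?_⟩
  · change M.act (h * x) m = M.act h (M.act x m)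
    simp
  · change M.act 1 m = m
    simp

/-- Tensor powers. -/
def tensorPow (M : LMod Q) : ℕ → LMod Q
  | 0 => 𝟙_ (LMod Q)
  | n + 1 => tensorPow M n ⊗ M

theorem finiteDimensional_tensorPow (M : LMod Q) [FiniteDimensional k M.carrier] (n : ℕ) :
    FiniteDimensional k (M.tensorPow n).carrier ∧
      Module.finrank k (M.tensorPow n).carrier = Module.finrank k M.carrier ^ n := by
  induction n with
  | zero => exact ⟨inferInstanceAs (FiniteDimensional k k), Module.finrank_self k⟩
  | succ n ih =>
    obtain ⟨h1, h2⟩ := ih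
    refine ⟨inferInstanceAs (FiniteDimensional k ((M.tensorPow n).carrier ⊗[k] M.carrier)), ?_⟩
    change Module.finrank k ((M.tensorPow n).carrier ⊗[k] M.carrier) = _
    rw [Module.finrank_tensorProduct, h2, pow_succ]

end QuasiBialgebra.LMod

/-! ### The indicator in terms of morphisms of the tensor category -/

namespace QuasiHopfAlgebra

open MonoidalCategory QuasiBialgebra

variable {k : Type u} [Field k] {H : Type u} [Ring H] [Algebra k H] {Q : QuasiHopfAlgebra k H}
variable {V : LMod Q.toQuasiBialgebra}

theorem zigzag_toLin (t : 𝟙_ (LMod Q.toQuasiBialgebra) ⟶ V ⊗ V)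
    (g : V ⊗ V ⟶ 𝟙_ (LMod Q.toQuasiBialgebra)) (v : V.carrier) :
    (zigzag t g).toLin v = Q.snake V.act (t.toLin (1 : k)) g.toLin v := by
  rfl

theorem unit_hom_invariant (t : 𝟙_ (LMod Q.toQuasiBialgebra) ⟶ V ⊗ V) (h : H) :
    boxAct V.act V.act (Q.comul h) (t.toLin (1 : k)) = Q.counit h • t.toLin (1 : k) := by
  have h1 := t.map_act h (1 : k)
  have h2 : ((𝟙_ (LMod Q.toQuasiBialgebra)).act h (1 : k) : k) = Q.counit h • (1 : k) := rfl
  refine h1.symm.trans ?_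
  exact (congrArg t.toLin h2).trans (t.toLin.map_smul (Q.counit h) (1 : k))

theorem hom_unit_invariant (g : V ⊗ V ⟶ 𝟙_ (LMod Q.toQuasiBialgebra)) (h : H)
    (x : V.carrier ⊗[k] V.carrier) :
    (g.toLin (boxAct V.act V.act (Q.comul h) x) : k) = Q.counit h • (g.toLin x : k) :=
  g.map_act h x

/-- The morphism `𝟙 ⟶ V ⊗ V` given by an invariant. -/
def unitHom (t : V.carrier ⊗[k] V.carrier)
    (ht : ∀ h, boxAct V.act V.act (Q.comul h) t = Q.counit h • t) :
    𝟙_ (LMod Q.toQuasiBialgebra) ⟶ V ⊗ V where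
  toLin := LinearMap.toSpanSingleton k (V.carrier ⊗[k] V.carrier) t
  map_act h (c : k) := by
    change (Q.counit h • c) • t = boxAct V.act V.act (Q.comul h) (c • t)
    rw [map_smul, ht, smul_smul, smul_eq_mul, mul_comm]

variable [IsSemisimpleRing H]

theorem char_nu_eq_zero [FiniteDimensional k V.carrier]
    (h : ∀ t : 𝟙_ (LMod Q.toQuasiBialgebra) ⟶ V ⊗ V, t = 0) : V.char Q.nu = 0 := by
  rw [LMod.char_apply]
  refine trace_nu_eq_zero (fun t ht => ?_)
  have h1 := congrArg (fun f => LMod.Hom.toLin f (1 : k)) (h (unitHom t ht))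
  change (1 : k) • t = 0 at h1
  rwa [one_smul] at h1

theorem exists_comp_eq_id (t : 𝟙_ (LMod Q.toQuasiBialgebra) ⟶ V ⊗ V) (ht : t ≠ 0) :
    ∃ g : V ⊗ V ⟶ 𝟙_ (LMod Q.toQuasiBialgebra), t ≫ g = 𝟙 _ := by
  obtain ⟨g, hg, h1⟩ := exists_form_eq_one (Q := Q) (unit_hom_invariant t) (fun h0 => ht (by
    apply LMod.hom_ext
    exact LinearMap.ext_ring h0))
  refine ⟨⟨g, hg⟩, ?_⟩
  apply LMod.hom_ext
  exact LinearMap.ext_ring h1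

theorem char_nu_eq [FiniteDimensional k V.carrier] (hV : V.IsBrick)
    (t : 𝟙_ (LMod Q.toQuasiBialgebra) ⟶ V ⊗ V) (g : V ⊗ V ⟶ 𝟙_ (LMod Q.toQuasiBialgebra))
    (htg : t ≫ g = 𝟙 _) {μ : k} (hμ : zigzag t g = μ • 𝟙 V) :
    V.char Q.nu = μ * Module.finrank k V.carrier := by
  refine trace_nu_eq hV.isAbsolutelyIrreducible (unit_hom_invariant t) (hom_unit_invariant g)
    ?_ (fun v => ?_)
  · exact congrArg (fun f => LMod.Hom.toLin f (1 : k)) htg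
  · rw [← zigzag_toLin, hμ]
    rfl

end QuasiHopfAlgebra

/-! ### Characters separate the irreducible modules -/

namespace QuasiBialgebra.LMod

open MonoidalCategory

section Characters

variable {k : Type u} [Field k] {H : Type u} [Ring H] [Algebra k H] {Q : QuasiBialgebra k H}

/-- Schur's lemma: nonzero maps between bricks are isomorphisms. -/
theorem IsBrick.nonempty_iso [IsSemisimpleRing H] {M N : LMod Q} (hM : M.IsBrick) (hN : N.IsBrick)
    (f : M ⟶ N) (hf : f ≠ 0) : Nonempty (M ≅ N) := by
  have hker := (hM.isAbsolutelyIrreducible.eq_bot_or_eq_top (LinearMap.ker f.toLin)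
    (fun h w hw => by
      rw [LinearMap.mem_ker] at hw ⊢
      rw [f.map_act, hw, map_zero])).resolve_right
    (fun h => hf (hom_ext (LinearMap.ker_eq_top.mp h)))
  have hrange := (hN.isAbsolutelyIrreducible.eq_bot_or_eq_top (LinearMap.range f.toLin) (by
    rintro h _ ⟨m, rfl⟩
    exact ⟨M.act h m, f.map_act h m⟩)).resolve_left
    (fun h => hf (hom_ext (LinearMap.range_eq_bot.mp h)))
  exact ⟨isoOfLinearEquiv (LinearEquiv.ofBijective f.toLin
    ⟨LinearMap.ker_eq_bot.mp hker, LinearMap.range_eq_top.mp hrange⟩) f.map_act⟩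

/-- Some element of `H` acts as the identity on `M` and as zero on `N` if there are no nonzero maps
between `M` and `N`. -/
theorem exists_act_eq_one_and_eq_zero [IsSemisimpleRing H] (M N : LMod Q)
    [FiniteDimensional k M.carrier] [FiniteDimensional k N.carrier]
    (hMN : ∀ f : M ⟶ N, f = 0) (hNM : ∀ f : N ⟶ M, f = 0) :
    ∃ h : H, M.act h = 1 ∧ N.act h = 0 := by
  let := M.moduleH
  let := N.moduleH
  have := M.isScalarTower_moduleH
  have := N.isScalarTower_moduleH
  have hMN' : ∀ (f : M.carrier →ₗ[H] N.carrier) m, f m = 0 := fun f m =>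
    LinearMap.congr_fun (congrArg Hom.toLin
      (hMN ⟨f.restrictScalars k, fun h m => f.map_smul h m⟩)) m
  have hNM' : ∀ (f : N.carrier →ₗ[H] M.carrier) m, f m = 0 := fun f m =>
    LinearMap.congr_fun (congrArg Hom.toLin
      (hNM ⟨f.restrictScalars k, fun h m => f.map_smul h m⟩)) m
  -- Without nonzero maps between `M` and `N`, every endomorphism of `M × N` is diagonal, so the
  -- projection to `M` lies in the bicommutant. Jacobson density on a finite `k`-spanning set then
  -- realizes it by an element of `H`.
  let p : Module.End (Module.End H (M.carrier × N.carrier)) (M.carrier × N.carrier) :=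
    { toFun := fun x => (x.1, 0)
      map_add' := fun x y => by simp
      map_smul' := fun φ x => by
        have h1 : (φ (x.1, 0)).2 = 0 :=
          hMN' (LinearMap.snd H _ _ ∘ₗ φ ∘ₗ LinearMap.inl H _ _) x.1
        have h2 : (φ (0, x.2)).1 = 0 :=
          hNM' (LinearMap.fst H _ _ ∘ₗ φ ∘ₗ LinearMap.inr H _ _) x.2
        have h3 : φ x = φ (x.1, 0) + φ (0, x.2) := by rw [← map_add]; simp
        change ((φ x).1, (0 : N.carrier)) = φ (x.1, 0)
        ext
        · simp [h3, h2]
        · exact h1.symm }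
  obtain ⟨s, hs⟩ := Module.Finite.fg_top (R := k) (M := M.carrier × N.carrier)
  obtain ⟨h, hh⟩ := jacobson_density p s
  have hall : ∀ x : M.carrier × N.carrier, (x.1, (0 : N.carrier)) = (M.act h x.1, N.act h x.2) := by
    intro x
    have hx : x ∈ Submodule.span k (s : Set (M.carrier × N.carrier)) := hs ▸ Submodule.mem_top
    induction hx using Submodule.span_induction with
    | mem x hx => exact hh x hx
    | zero => simp
    | add x y _ _ hx hy =>
      simp only [Prod.mk.injEq] at hx hy ⊢
      simp [← hx.1, ← hx.2, ← hy.1, ← hy.2]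
    | smul c x _ hx =>
      simp only [Prod.mk.injEq] at hx ⊢
      simp [← hx.1, ← hx.2]
  refine ⟨h, LinearMap.ext fun m => ?_, LinearMap.ext fun n => ?_⟩
  · exact (congrArg Prod.fst (hall (m, 0))).symm
  · exact (congrArg Prod.snd (hall (0, n))).symm

/-- If they were not isomorphic, an element acting as `1` on `M` and `0` on `N` would have traces
`dim M` and `0`, which differ in characteristic zero. -/
theorem IsBrick.nonempty_iso_of_char_eq [CharZero k] [IsSemisimpleRing H] [FiniteDimensional k H]
    {M N : LMod Q} (hM : M.IsBrick) (hN : N.IsBrick) (h : M.char = N.char) :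
    Nonempty (M ≅ N) := by
  have := hM.finiteDimensional
  have := hN.finiteDimensional
  have := hM.nontrivial
  by_contra hno
  obtain ⟨x, hx1, hx0⟩ := M.exists_act_eq_one_and_eq_zero N
    (fun f => by_contra fun hf => hno (hM.nonempty_iso hN f hf))
    (fun f => by_contra fun hf => hno ((hN.nonempty_iso hM f hf).map Iso.symm))
  have h1 := LinearMap.congr_fun h x
  rw [char_apply, char_apply, hx1, hx0, map_zero, LinearMap.trace_one] at h1
  exact (Module.finrank_pos (R := k) (M := M.carrier)).ne' (by exact_mod_cast h1)

/-- The characters of irreducible modules are the characters of bricks. -/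
theorem mem_irrChar_iff [IsAlgClosed k] [IsSemisimpleRing H] [FiniteDimensional k H]
    (Q : QuasiBialgebra k H) (χ : H →ₗ[k] k) :
    χ ∈ IrrChar k H ↔ ∃ M : LMod Q, M.IsBrick ∧ M.char = χ := by
  constructor
  · rintro ⟨M, _, _, _, _, hM, rfl⟩
    have : Module.Finite H M := inferInstance
    have : FiniteDimensional k M := Module.Finite.trans H M
    have := IsSimpleModule.nontrivial H M
    refine ⟨⟨M, Algebra.lsmul k k M⟩, ⟨fun h0 => ?_, fun f => ?_⟩, rfl⟩
    · obtain ⟨m, hm⟩ := exists_ne (0 : M)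
      exact hm (LinearMap.congr_fun (congrArg Hom.toLin h0) m)
    · let f' : Module.End H M :=
        { toFun := f.toLin, map_add' := f.toLin.map_add, map_smul' := f.map_act }
      obtain ⟨c, hc⟩ := (IsSimpleModule.algebraMap_end_bijective_of_isAlgClosed k).2 f'
      exact ⟨c, hom_ext (LinearMap.ext fun m => (LinearMap.congr_fun hc m).symm)⟩
  · rintro ⟨M, hM, rfl⟩
    let := M.moduleH
    have := M.isScalarTower_moduleH
    refine ⟨M.carrier, inferInstance, inferInstance, M.moduleH, this, ?_, rfl⟩
    have := hM.nontrivial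
    refine { eq_bot_or_eq_top := fun W => ?_ }
    refine (hM.isAbsolutelyIrreducible.eq_bot_or_eq_top (W.restrictScalars k)
      (fun h w hw => W.smul_mem h hw)).imp (fun h => ?_) (fun h => ?_)
    · simpa using h
    · simpa using h

end Characters

end QuasiBialgebra.LMod

/-! ### Transport along a tensor equivalence -/

namespace CategoryTheory.Functor

open MonoidalCategory LaxMonoidal OplaxMonoidal

variable {C D : Type*} [Category C] [MonoidalCategory C] [Category D] [MonoidalCategory D]

/-- Once the constraints of `F` are expanded through `μ`, `δ`, `ε`, `η`, the inner ones cancel in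
pairs. -/
theorem zigzag_map (F : C ⥤ D) [F.Monoidal] {V : C} (t : 𝟙_ C ⟶ V ⊗ V) (g : V ⊗ V ⟶ 𝟙_ C) :
    zigzag (ε F ≫ F.map t ≫ δ F V V) (μ F V V ≫ F.map g ≫ η F) = F.map (zigzag t g) := by
  simp only [zigzag, F.map_comp, Functor.Monoidal.map_associator, Functor.Monoidal.map_whiskerLeft,
    Functor.Monoidal.map_whiskerRight, Functor.Monoidal.map_leftUnitor_inv,
    Functor.Monoidal.map_rightUnitor, comp_whiskerRight, MonoidalCategory.whiskerLeft_comp,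
    Category.assoc, Functor.Monoidal.μ_δ_assoc]

end CategoryTheory.Functor

/-- The tensor power trick: if `a > b > 0`, the powers of `a / b` outgrow any constant `C`. -/
theorem Nat.le_of_pow_le_mul_pow {a b C : ℕ} (h : ∀ n, a ^ n ≤ C * b ^ n) : a ≤ b := by
  by_contra! hlt
  rcases Nat.eq_zero_or_pos b with rfl | hb
  · have := h 1
    simp at this
    omega
  · have hb' : (0 : ℝ) < b := by exact_mod_cast hb
    obtain ⟨n, hn⟩ := pow_unbounded_of_one_lt (C : ℝ)
      (show (1 : ℝ) < a / b by rw [one_lt_div hb']; exact_mod_cast hlt)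
    rw [div_pow, lt_div_iff₀ (by positivity)] at hn
    exact absurd (h n) (not_le.mpr (by exact_mod_cast hn))

namespace QuasiBialgebra.LMod

open MonoidalCategory Functor.LaxMonoidal Functor.OplaxMonoidal

section Equivalence

variable {k : Type u} [Field k] {H H' : Type u} [Ring H] [Algebra k H] [Ring H'] [Algebra k H']
  {Q : QuasiBialgebra k H} {Q' : QuasiBialgebra k H'}
  (F : LMod Q ⥤ LMod Q') [F.IsEquivalence] [F.Additive] [F.Linear k]

theorem IsBrick.map {M : LMod Q} (hM : M.IsBrick) : (F.obj M).IsBrick := by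
  refine ⟨fun h0 => hM.1 (F.map_injective ?_), fun f => ?_⟩
  · rw [F.map_id, h0, F.map_zero]
  · obtain ⟨c, hc⟩ := hM.2 (F.preimage f)
    exact ⟨c, by rw [← F.map_preimage f, hc, F.map_smul, F.map_id]⟩

theorem IsBrick.of_map {M : LMod Q} (hM : (F.obj M).IsBrick) : M.IsBrick := by
  refine ⟨fun h0 => hM.1 ?_, fun f => ?_⟩
  · rw [← F.map_id, h0, F.map_zero]
  · obtain ⟨c, hc⟩ := hM.2 (F.map f)
    exact ⟨c, F.map_injective (by rw [hc, F.map_smul, F.map_id])⟩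

theorem IsBrick.of_iso {M N : LMod Q} (e : M ≅ N) (hM : M.IsBrick) : N.IsBrick := by
  refine ⟨fun h0 => hM.1 ?_, fun f => ?_⟩
  · rw [← e.hom_inv_id, ← Category.comp_id e.hom, h0]
    simp
  · obtain ⟨c, hc⟩ := hM.2 (e.hom ≫ f ≫ e.inv)
    refine ⟨c, ?_⟩
    rw [← cancel_epi e.hom, ← cancel_mono e.inv, Category.assoc, hc]
    simp

theorem finiteDimensional_obj [FiniteDimensional k H'] [IsSemisimpleRing H'] (M : LMod Q) [FiniteDimensional k M.carrier] :
    FiniteDimensional k (F.obj M).carrier := by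
  have : FiniteDimensional k (F.obj M ⟶ F.obj M) :=
    Module.Finite.of_surjective (F.mapLinearMap k) F.map_surjective
  exact finiteDimensional_of_end _

theorem finiteDimensional_of_obj [FiniteDimensional k H] [IsSemisimpleRing H] (M : LMod Q) [FiniteDimensional k (F.obj M).carrier] :
    FiniteDimensional k M.carrier := by
  have : FiniteDimensional k (M ⟶ M) :=
    Module.Finite.of_injective (F.mapLinearMap k (X := M) (Y := M)) F.map_injective
  exact finiteDimensional_of_end _

theorem nonempty_tensorPow_iso (G : LMod Q ⥤ LMod Q') [G.Monoidal] (M : LMod Q) (n : ℕ) :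
    Nonempty (G.obj (M.tensorPow n) ≅ (G.obj M).tensorPow n) := by
  induction n with
  | zero => exact ⟨(Functor.Monoidal.εIso G).symm⟩
  | succ n ih =>
    obtain ⟨e⟩ := ih
    exact ⟨(Functor.Monoidal.μIso G (M.tensorPow n) M).symm ≪≫ (e ⊗ᵢ Iso.refl (G.obj M))⟩

variable [FiniteDimensional k H] [FiniteDimensional k H']

/-- `M` is a quotient of `Hom(H, M)`, which embeds in `Hom(F(H), F(M))`. The constant `dim F(H)`
does not depend on `M`. -/
theorem finrank_le_mul_finrank_obj [IsSemisimpleRing H'] (M : LMod Q) [FiniteDimensional k M.carrier] :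
    Module.finrank k M.carrier ≤
      Module.finrank k (F.obj (regular Q)).carrier * Module.finrank k (F.obj M).carrier := by
  have := finiteDimensional_obj F M
  have := finiteDimensional_obj F (regular Q)
  calc Module.finrank k M.carrier ≤ Module.finrank k (regular Q ⟶ M) :=
        LinearMap.finrank_le_finrank_of_surjective M.evalOne_surjective
    _ ≤ Module.finrank k (F.obj (regular Q) ⟶ F.obj M) :=
        LinearMap.finrank_le_finrank_of_injective (f := F.mapLinearMap k) F.map_injective
    _ ≤ _ := finrank_hom_le _ _

variable [IsSemisimpleRing H]

/-- The constant is `dim P` for a module `P` with `F(P) ≅ H'`: a vector of `F(M)` is a map `H' →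
F(M)`, hence comes from a map `P → M`. -/
theorem exists_finrank_obj_le : ∃ C, ∀ (M : LMod Q) [FiniteDimensional k M.carrier],
    Module.finrank k (F.obj M).carrier ≤ C * Module.finrank k M.carrier := by
  let P := F.objPreimage (regular Q')
  let e : F.obj P ≅ regular Q' := F.objObjPreimageIso (regular Q')
  have : FiniteDimensional k (F.obj P).carrier :=
    Module.Finite.equiv (toLinearEquiv e).symm
  have : FiniteDimensional k P.carrier := finiteDimensional_of_obj F P
  refine ⟨Module.finrank k P.carrier, fun M _ => ?_⟩
  let f : (P ⟶ M) →ₗ[k] (regular Q' ⟶ F.obj M) :=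
    Linear.leftComp k _ e.inv ∘ₗ F.mapLinearMap k
  have hf : Function.Surjective f := fun y => ⟨F.preimage (e.hom ≫ y), by simp [f]⟩
  calc Module.finrank k (F.obj M).carrier ≤ Module.finrank k (P ⟶ M) :=
        LinearMap.finrank_le_finrank_of_surjective
          (f := (F.obj M).evalOne ∘ₗ f) ((F.obj M).evalOne_surjective.comp hf)
    _ ≤ _ := finrank_hom_le _ _

variable [IsSemisimpleRing H'] [F.Monoidal]

/-- The two linear bounds hold for every tensor power of `M`, whose image under `F` has dimension
`(dim F(M))ⁿ`; letting `n` grow removes the constants. -/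
theorem finrank_obj (M : LMod Q) [FiniteDimensional k M.carrier] :
    Module.finrank k (F.obj M).carrier = Module.finrank k M.carrier := by
  have := finiteDimensional_obj F M
  have hpow : ∀ n, Module.finrank k (F.obj (M.tensorPow n)).carrier =
      Module.finrank k (F.obj M).carrier ^ n := fun n => by
    rw [← (finiteDimensional_tensorPow (F.obj M) n).2]
    exact (toLinearEquiv (nonempty_tensorPow_iso F M n).some).finrank_eq
  apply le_antisymm
  · obtain ⟨C, hC⟩ := exists_finrank_obj_le F
    refine Nat.le_of_pow_le_mul_pow (C := C) fun n => ?_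
    have := (finiteDimensional_tensorPow M n).1
    rw [← hpow, ← (finiteDimensional_tensorPow M n).2]
    exact hC _
  · refine Nat.le_of_pow_le_mul_pow
      (C := Module.finrank k (F.obj (regular Q)).carrier) fun n => ?_
    have := (finiteDimensional_tensorPow M n).1
    rw [← hpow, ← (finiteDimensional_tensorPow M n).2]
    exact finrank_le_mul_finrank_obj F _

end Equivalence

/-- Tensor equivalences preserve the indicators of bricks. -/
theorem IsBrick.char_obj_nu {k : Type u} [Field k] {H H' : Type u} [Ring H] [Algebra k H]
    [FiniteDimensional k H] [IsSemisimpleRing H] [Ring H'] [Algebra k H'] [FiniteDimensional k H']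
    [IsSemisimpleRing H'] (Q : QuasiHopfAlgebra k H) (Q' : QuasiHopfAlgebra k H')
    (F : LMod Q.toQuasiBialgebra ⥤ LMod Q'.toQuasiBialgebra) [F.IsEquivalence] [F.Monoidal]
    [F.Additive] [F.Linear k] {M : LMod Q.toQuasiBialgebra} (hM : M.IsBrick) :
    (F.obj M).char Q'.nu = M.char Q.nu := by
  have := hM.finiteDimensional
  have := (hM.map F).finiteDimensional
  by_cases h : ∀ t : 𝟙_ (LMod Q.toQuasiBialgebra) ⟶ M ⊗ M, t = 0
  · rw [QuasiHopfAlgebra.char_nu_eq_zero h, QuasiHopfAlgebra.char_nu_eq_zero (fun t => ?_)]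
    -- Fullness pulls an invariant of `F(M) ⊗ F(M)` back to one of `M ⊗ M`, so the vanishing case
    -- transfers.
    have h1 := congrArg F.map (h (F.preimage (η F ≫ t ≫ μ F M M)))
    rw [F.map_preimage, F.map_zero] at h1
    have h2 := congrArg (fun f => ε F ≫ f ≫ δ F M M) h1
    simpa using h2
  · push Not at h
    obtain ⟨t, ht⟩ := h
    obtain ⟨g, hg⟩ := QuasiHopfAlgebra.exists_comp_eq_id t ht
    obtain ⟨c, hc⟩ := hM.2 (zigzag t g)
    -- Both indicators are evaluated with the same scalar `c`, using on `F(M)` the transported pair;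
    -- only the dimensions remain to be compared.
    rw [QuasiHopfAlgebra.char_nu_eq hM t g hg hc,
      QuasiHopfAlgebra.char_nu_eq (hM.map F) (ε F ≫ F.map t ≫ δ F M M) (μ F M M ≫ F.map g ≫ η F)
        ?_ (μ := c) ?_, finrank_obj]
    · simp [← F.map_comp_assoc, hg]
    · rw [F.zigzag_map, hc, F.map_smul, F.map_id]

end QuasiBialgebra.LMod

end

open QuasiBialgebra.LMod in
theorem theorem4p1 {k : Type u} [Field k] [IsAlgClosed k] [CharZero k]
    {H H' : Type u}
    [Ring H] [Algebra k H] [FiniteDimensional k H] [IsSemisimpleRing H]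
    [Ring H'] [Algebra k H'] [FiniteDimensional k H'] [IsSemisimpleRing H']
    (Q : QuasiHopfAlgebra k H) (Q' : QuasiHopfAlgebra k H')
    (F : QuasiBialgebra.LMod Q.toQuasiBialgebra ⥤ QuasiBialgebra.LMod Q'.toQuasiBialgebra)
    [F.IsEquivalence] [F.Monoidal] [F.Additive] [F.Linear k] :
    ∃ e : IrrChar k H ≃ IrrChar k H',
      ∀ χ : IrrChar k H, (e χ : H' →ₗ[k] k) Q'.nu = (χ : H →ₗ[k] k) Q.nu := by
  choose M hM hχ using fun χ : IrrChar k H => (mem_irrChar_iff Q.toQuasiBialgebra χ.1).mp χ.2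
  let e : IrrChar k H → IrrChar k H' := fun χ =>
    ⟨(F.obj (M χ)).char, (mem_irrChar_iff Q'.toQuasiBialgebra _).mpr ⟨_, (hM χ).map F, rfl⟩⟩
  have he : Function.Bijective e := by
    constructor
    · intro χ ψ h
      obtain ⟨i⟩ := ((hM χ).map F).nonempty_iso_of_char_eq ((hM ψ).map F) (congrArg Subtype.val h)
      apply Subtype.ext
      rw [← hχ χ, ← hχ ψ]
      exact char_eq_of_iso (F.preimageIso i)
    · rintro ⟨χ', h'⟩
      obtain ⟨N, hN, rfl⟩ := (mem_irrChar_iff Q'.toQuasiBialgebra χ').mp h'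
      let i := F.objObjPreimageIso N
      have hP : (F.objPreimage N).IsBrick := (hN.of_iso i.symm).of_map F
      let χ : IrrChar k H := ⟨(F.objPreimage N).char, (mem_irrChar_iff _ _).mpr ⟨_, hP, rfl⟩⟩
      -- The module chosen for `χ` need not be the preimage of `N`, but it has the same character
      -- and so is isomorphic to it.
      obtain ⟨j⟩ := (hM χ).nonempty_iso_of_char_eq hP (hχ χ)
      exact ⟨χ, Subtype.ext (char_eq_of_iso (F.mapIso j ≪≫ i))⟩
  refine ⟨Equiv.ofBijective e he, fun χ => ?_⟩
  change (F.obj (M χ)).char Q'.nu = _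
  rw [(hM χ).char_obj_nu Q Q' F, hχ]
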